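/- Let $\mathfrak H_r=\{z\in\mathbf C : \operatorname{Im} z>r\}$ for $r\in\mathbf R$ and $\mathfrak H=\mathfrak H_0$. Let $g$ be a function holomorphic on some half plane $\mathfrak H_r$ and satisfying there $g(z+h)=u\,g(z)$ for some real $h>0$ and some $u\in\mathbf C$ with $|u|=1$. Then $g$ has a unique expansion $$g(z)=\sum_{\lambda\in\Lambda}a(\lambda)e^{2\pi i\lambda z},\qquad \Lambda=\{\lambda\in\mathbf R : e^{2\pi i\lambda h}=u\},$$ on $\mathfrak H_r$, called its expansion at $\infty$. One says that $g$ has finite order at $\infty$ if only finitely many $\lambda<0$ in $\Lambda$ satisfy $a(\lambda)\neq0$. In that case $g$ is called strongly non-lacunary if there are $\lambda_0\in\Lambda$ and an integer $m\geq1$ such that $a(\lambda_0+m h^{-1}n)\neq0$ for all integers $n\geq0$ (these points lie in $\Lambda$). These notions do not depend on the choice of $h$ and $u$. Let $\Gamma$ be a finite index subgroup of $\mathbf{SL}_2(\mathbf Z)$ and $k$ a real number; complex powers $w^{-k}$ are defined by the logarithm with imaginary part in $]-\pi,\pi]$. A modular function of weight $k$ for $\Gamma$ is a meromorphic function $f$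 on $\mathfrak H$ such that: (a) for each $\gamma=\begin{pmatrix}a&b\\c&d\end{pmatrix}\in\Gamma$ there is a holomorphic function $j(\gamma,\cdot)$ on $\mathfrak H$ with $|j(\gamma,z)|=|cz+d|^k$ and $f\left(\frac{az+b}{cz+d}\right)=j(\gamma,z)f(z)$ for $z\in\mathfrak H$; (b) for each $\begin{pmatrix}a&b\\c&d\end{pmatrix}\in\mathbf{SL}_2(\mathbf Z)$, the function $z\mapsto(cz+d)^{-k}f\left(\frac{az+b}{cz+d}\right)$ is holomorphic on some half plane $\mathfrak H_r$ (hence, by (a), satisfies the conditions imposed on $g$ above) and has finite order at $\infty$. **Theorem 2.** Let $f$ be a non-zero modular function of weight $k$ for $\Gamma$ that is holomorphic on $\mathfrak H$. If $k<0$, then $f$ is strongly non-lacunary. -/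

import Mathlib

open scoped MatrixGroups

noncomputable section

/-- The half plane `{z ∈ ℂ | Im z > r}`; the upper half plane is `halfPlane 0`. -/
def halfPlane (r : ℝ) : Set ℂ := {z : ℂ | r < z.im}

/-- The set `Λ` of real `μ` with `e^{2πi μ h} = u`. -/
def expLattice (h : ℝ) (u : ℂ) : Set ℝ :=
  {μ : ℝ | Complex.exp (2 * Real.pi * Complex.I * μ * h) = u}

/-- `g` is holomorphic on some half plane `Im z > r`, satisfies there `g (z + h) = u g (z)` with
`h > 0` and `|u| = 1`, and `g z = ∑_{μ ∈ Λ} a μ e^{2πi μ z}` there (unconditional, i.e. absolute,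
convergence), where `Λ = expLattice h u`. Only the values of `a` on `Λ` matter. -/
structure IsExpansionAtInfty (g : ℂ → ℂ) (h : ℝ) (u : ℂ) (a : ℝ → ℂ) : Prop where
  h_pos : 0 < h
  norm_u : ‖u‖ = 1
  expansion : ∃ r : ℝ, DifferentiableOn ℂ g (halfPlane r) ∧
    (∀ z ∈ halfPlane r, g (z + h) = u * g z) ∧
    ∀ z ∈ halfPlane r,
      HasSum (fun μ : expLattice h u =>
        a (μ : ℝ) * Complex.exp (2 * Real.pi * Complex.I * (μ : ℝ) * z)) (g z)

/-- `g` has an expansion at infinity with only finitely many non-zero coefficients of negative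
index. The expansion is unique, so this does not depend on the choices of `h`, `u`, `a`. -/
def HasFiniteOrderAtInfty (g : ℂ → ℂ) : Prop :=
  ∃ (h : ℝ) (u : ℂ) (a : ℝ → ℂ), IsExpansionAtInfty g h u a ∧
    {μ : ℝ | μ ∈ expLattice h u ∧ μ < 0 ∧ a μ ≠ 0}.Finite

/-- `g` has finite order at infinity, and the coefficients of its expansion at infinity are all
non-zero on some arithmetic progression `μ₀ + m h⁻¹ ℕ`, `m ≥ 1`, contained in `Λ`. -/
def StronglyNonLacunary (g : ℂ → ℂ) : Prop :=
  HasFiniteOrderAtInfty g ∧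
  ∃ (h : ℝ) (u : ℂ) (a : ℝ → ℂ), IsExpansionAtInfty g h u a ∧
    ∃ μ₀ : ℝ, ∃ m : ℕ, 0 < m ∧
      ∀ n : ℕ, μ₀ + m * h⁻¹ * n ∈ expLattice h u ∧ a (μ₀ + m * h⁻¹ * n) ≠ 0

/-- `cz + d` for `γ = (a b; c d)`. -/
def autDenom (γ : SL(2, ℤ)) (z : ℂ) : ℂ := (γ 1 0 : ℂ) * z + (γ 1 1 : ℂ)

/-- `γ z = (az + b) / (cz + d)` for `γ = (a b; c d)`. -/
def moebius (γ : SL(2, ℤ)) (z : ℂ) : ℂ :=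
  ((γ 0 0 : ℂ) * z + (γ 0 1 : ℂ)) / autDenom γ z

/-- Modular functions of real weight `k` for `Γ`, with arbitrary automorphy factors.
A meromorphic function on the upper half plane is represented by a function in normal form there
(it has the value `0` at its poles, and its limit as value elsewhere), so that identities between
meromorphic functions become pointwise identities. Values off the upper half plane are
irrelevant. -/
structure IsModularFunction (Γ : Subgroup SL(2, ℤ)) (k : ℝ) (f : ℂ → ℂ) : Prop where
  meromorphic : MeromorphicNFOn f (halfPlane 0)
  automorphy : ∀ γ ∈ Γ, ∃ j : ℂ → ℂ, DifferentiableOn ℂ j (halfPlane 0) ∧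
    (∀ z ∈ halfPlane 0, ‖j z‖ = ‖autDenom γ z‖ ^ k) ∧
    ∀ z ∈ halfPlane 0, f (moebius γ z) = j z * f z
  finite_order : ∀ γ : SL(2, ℤ),
    HasFiniteOrderAtInfty (fun z => autDenom γ z ^ (-k : ℂ) * f (moebius γ z))

end

open scoped MatrixGroups
open Filter Topology MeasureTheory

/-! The proof is a circle method in which only finitely many cusps modulo the period matter. The
coefficient `a μ` is an integral of `f z * expi (-μ) z` over one period at any height `y`
(`IsExpansionAtInfty.integral_eq_coeff`). Near a finite cusp `a/c`, with `w = z - a/c`, the function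
grows like `exp (2π (ν/c²) Im (-1/w))`, where `ν` is the order of growth of the slash transform at
infinity. By invariance under `Γ`, `ν` takes finitely many values
(`IsModularFunction.exists_growth_exponents`).

Some `ν` at a finite cusp is positive. Otherwise reduction theory gives `f = O(y^(-k/2))` as `y →
0`; since `k < 0` this tends to zero, and it kills every coefficient (`exists_growth_exponent_pos`).
Large `c` make `ν/c²` small, so `ν/c²` attains a maximum `M > 0`, is bounded by some `M' < M` at all
non-dominant cusps, and the dominant cusps have a common denominator `Q`
(`exists_dominant_exponent`).

At height `y = √(M/μ)` each dominant cusp contributes a saddle point of the same order of magnitude,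
and everything else is exponentially smaller (`exists_tendsto_local_integral`). Hence `a μ`,
suitably normalized, is asymptotic to a finite sum of phases `expi (-μ) (j/Q)` with constant
weights, not all zero. The phases depend only on `μ` modulo `Q`, and a Vandermonde argument
(`exists_sum_expi_ne_zero`) gives a class modulo `Q` on which the sum is non-zero. All sufficiently
large `μ` in that class have `a μ ≠ 0`. -/

/-! ### Exponentials and Fourier coefficients -/

/-- The function `z ↦ e^{2πiμz}`. -/
noncomputable def expi (μ : ℝ) (z : ℂ) : ℂ := Complex.exp (2 * Real.pi * Complex.I * μ * z)

lemma norm_expi (μ : ℝ) (z : ℂ) : ‖expi μ z‖ = Real.exp (-(2 * Real.pi * μ * z.im)) := by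
  rw [expi, Complex.norm_exp]
  congr 1
  simp [Complex.mul_re, Complex.mul_im]

lemma expi_ne_zero (μ : ℝ) (z : ℂ) : expi μ z ≠ 0 := Complex.exp_ne_zero _

lemma expi_add_left (μ ν : ℝ) (z : ℂ) : expi (μ + ν) z = expi μ z * expi ν z := by
  rw [expi, expi, expi, ← Complex.exp_add]; congr 1; push_cast; ring

lemma expi_add_right (μ : ℝ) (z w : ℂ) : expi μ (z + w) = expi μ z * expi μ w := by
  rw [expi, expi, expi, ← Complex.exp_add]; congr 1; ring

lemma expi_neg_mul_self (μ : ℝ) (z : ℂ) : expi (-μ) z * expi μ z = 1 := by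
  rw [← expi_add_left]; simp [expi]

lemma differentiable_expi (μ : ℝ) : Differentiable ℂ (expi μ) := by
  unfold expi; fun_prop

@[fun_prop]
lemma continuous_expi (μ : ℝ) : Continuous (expi μ) := (differentiable_expi μ).continuous

lemma mem_expLattice {h : ℝ} {u : ℂ} {μ : ℝ} : μ ∈ expLattice h u ↔ expi μ h = u := Iff.rfl

lemma exists_expLattice_eq_range {h : ℝ} (hh : 0 < h) {u : ℂ} (hu : ‖u‖ = 1) :
    ∃ μ₀ : ℝ, expLattice h u = Set.range (fun n : ℤ => μ₀ + n / h) := by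
  have hpi := Real.pi_pos
  have hhC : (h : ℂ) ≠ 0 := by exact_mod_cast hh.ne'
  have hpiC : (Real.pi : ℂ) ≠ 0 := by exact_mod_cast hpi.ne'
  refine ⟨u.arg / (2 * Real.pi * h), ?_⟩
  have hu0 : u ≠ 0 := by rintro rfl; simp at hu
  have hue : Complex.exp (u.arg * Complex.I) = u := by
    have := Complex.norm_mul_exp_arg_mul_I u
    rwa [hu, Complex.ofReal_one, one_mul] at this
  ext μ
  rw [mem_expLattice, expi]
  constructor
  · intro hμ
    rw [← hue, Complex.exp_eq_exp_iff_exists_int] at hμ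
    obtain ⟨n, hn⟩ := hμ
    refine ⟨n, ?_⟩
    have h2 : (2 * Real.pi * μ * h : ℂ) = u.arg + n * (2 * Real.pi) := by
      have := Complex.I_ne_zero
      apply mul_right_cancel₀ this
      linear_combination hn
    have h3 : 2 * Real.pi * μ * h = u.arg + n * (2 * Real.pi) := by exact_mod_cast h2
    simp only
    field_simp
    linarith
  · rintro ⟨n, rfl⟩
    rw [← hue]
    rw [Complex.exp_eq_exp_iff_exists_int]
    refine ⟨n, ?_⟩
    rw [hue]
    push_cast
    field_simp

lemma add_int_div_injective {h : ℝ} (hh : 0 < h) (μ₀ : ℝ) :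
    Function.Injective (fun n : ℤ => μ₀ + n / h) := by
  intro m n hmn
  simp only at hmn
  field_simp at hmn
  exact_mod_cast (by linarith : (m : ℝ) = n)

lemma hasSum_expLattice_iff {h : ℝ} (hh : 0 < h) {u : ℂ} {μ₀ : ℝ}
    (hr : expLattice h u = Set.range (fun n : ℤ => μ₀ + n / h)) (F : ℝ → ℂ) (s : ℂ) :
    HasSum (fun μ : expLattice h u => F μ) s ↔ HasSum (fun n : ℤ => F (μ₀ + n / h)) s := by
  rw [hr]
  exact ((Equiv.ofInjective _ (add_int_div_injective hh μ₀)).hasSum_iff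
    (f := fun μ : Set.range (fun n : ℤ => μ₀ + n / h) => F μ)).symm

lemma integral_expi_int_div {h : ℝ} (hh : 0 < h) (n : ℤ) (x₀ y : ℝ) :
    ∫ x in x₀..(x₀ + h), expi (n / h) (x + y * Complex.I) = if n = 0 then (h : ℂ) else 0 := by
  split_ifs with hn
  · subst hn; simp [expi]
  have hhC : (h : ℂ) ≠ 0 := by exact_mod_cast hh.ne'
  have hpiC : (Real.pi : ℂ) ≠ 0 := by exact_mod_cast Real.pi_pos.ne'
  have hnC : (n : ℂ) ≠ 0 := by exact_mod_cast hn
  have key : ∀ x : ℝ, expi (n / h) (x + y * Complex.I) =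
      Complex.exp ((2 * Real.pi * Complex.I * n / h) * x) * expi (n / h) (y * Complex.I) := by
    intro x
    rw [expi_add_right, expi]
    congr 2
    push_cast; ring
  simp_rw [key]
  rw [intervalIntegral.integral_mul_const, integral_exp_mul_complex]
  · have : Complex.exp (2 * Real.pi * Complex.I * n / h * ((x₀ + h : ℝ) : ℂ)) =
        Complex.exp (2 * Real.pi * Complex.I * n / h * x₀) := by
      rw [Complex.exp_eq_exp_iff_exists_int]
      refine ⟨n, ?_⟩
      push_cast
      field_simp
    rw [this]; simp
  · simp [hpiC, hnC, hhC, Complex.I_ne_zero]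

/-- The coefficients of a series `∑ b n e^{2πi(μ₀ + n/h)z}` are given by integrals over a period. -/
lemma integral_mul_expi_eq_coeff {h : ℝ} (hh : 0 < h) (μ₀ : ℝ) (b : ℤ → ℂ) (G : ℝ → ℂ) (x₀ y : ℝ)
    (hs : ∀ x : ℝ, HasSum (fun n : ℤ => b n * expi (μ₀ + n / h) (x + y * Complex.I)) (G x))
    (n : ℤ) :
    ∫ x in x₀..(x₀ + h), G x * expi (-(μ₀ + n / h)) (x + y * Complex.I) = h * b n := by
  set B : ℤ → ℝ := fun m => ‖b m * expi (μ₀ + m / h) (y * Complex.I)‖ *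
    ‖expi (-(μ₀ + n / h)) (y * Complex.I)‖ with hB
  have hnorm : ∀ (μ x : ℝ), ‖expi μ (x + y * Complex.I)‖ = ‖expi μ (y * Complex.I)‖ := by
    intro μ x; simp [norm_expi]
  have hBs : Summable B := by
    have := (hs 0).summable.norm
    simp only [Complex.ofReal_zero, zero_add] at this
    exact this.mul_right _
  have key := intervalIntegral.hasSum_integral_of_dominated_convergence
    (μ := volume) (a := x₀) (b := x₀ + h)
    (F := fun (m : ℤ) (x : ℝ) => b m * expi (μ₀ + m / h) (x + y * Complex.I) *
      expi (-(μ₀ + n / h)) (x + y * Complex.I))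
    (f := fun x : ℝ => G x * expi (-(μ₀ + n / h)) (x + y * Complex.I))
    (fun m _ => B m)
    (fun m => by
      apply Continuous.aestronglyMeasurable
      fun_prop)
    (fun m => Eventually.of_forall fun x _ => by
      simp only [hB, norm_mul, hnorm]; rfl)
    (Eventually.of_forall fun x _ => hBs)
    (intervalIntegrable_const)
    (Eventually.of_forall fun x _ => (hs x).mul_right _)
  have hterm : ∀ m : ℤ, (∫ x in x₀..(x₀ + h), b m * expi (μ₀ + m / h) (x + y * Complex.I) *
      expi (-(μ₀ + n / h)) (x + y * Complex.I)) = if m = n then h * b n else 0 := by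
    intro m
    have : ∀ x : ℝ, b m * expi (μ₀ + m / h) (x + y * Complex.I) *
      expi (-(μ₀ + n / h)) (x + y * Complex.I) =
        b m * expi ((m - n : ℤ) / h) (x + y * Complex.I) := by
      intro x
      rw [mul_assoc, ← expi_add_left]
      congr 2
      push_cast; ring
    simp_rw [this]
    rw [intervalIntegral.integral_const_mul, integral_expi_int_div hh]
    by_cases hmn : m = n
    · subst hmn; simp [mul_comm]
    · simp [hmn, sub_eq_zero]
  simp_rw [hterm] at key
  exact key.unique (hasSum_ite_eq n _)

/-! ### Growth exponents at infinity -/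

/-- `g z = A e^{-2πiνz} + O(e^{2π(ν-ε) Im z})` as `Im z → ∞`, for some `ε > 0`. -/
def HasLeadingTerm (g : ℂ → ℂ) (ν : ℝ) (A : ℂ) : Prop :=
  ∃ ε > 0, ∃ C R : ℝ, ∀ z : ℂ, R ≤ z.im →
    ‖g z - A * expi (-ν) z‖ ≤ C * Real.exp (2 * Real.pi * (ν - ε) * z.im)

/-- Finite order and discreteness of `Λ` bound the support of the coefficients below, and
non-vanishing makes the support non-empty. The least exponent then dominates, and the spacing `1 /
h` of `Λ` is the gain in the error term. -/
lemma HasFiniteOrderAtInfty.exists_hasLeadingTerm {g : ℂ → ℂ} (hg : HasFiniteOrderAtInfty g)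
    (hne : ∀ R : ℝ, ∃ z : ℂ, R < z.im ∧ g z ≠ 0) :
    ∃ ν : ℝ, ∃ A : ℂ, A ≠ 0 ∧ HasLeadingTerm g ν A := by
  obtain ⟨h, u, a, ⟨hh, hu, r, -, -, hs⟩, hfin⟩ := hg
  obtain ⟨μ₀, hr⟩ := exists_expLattice_eq_range hh hu
  have hs' : ∀ z : ℂ, r < z.im →
      HasSum (fun n : ℤ => a (μ₀ + n / h) * expi (μ₀ + n / h) z) (g z) := fun z hz =>
    (hasSum_expLattice_iff hh hr (fun μ => a μ * expi μ z) _).1 (hs z hz)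
  have hex : ∃ n : ℤ, a (μ₀ + n / h) ≠ 0 := by
    by_contra! hcon
    obtain ⟨z, hz, hgz⟩ := hne r
    apply hgz
    have := hs' z hz
    simp only [hcon, zero_mul] at this
    exact this.unique hasSum_zero
  have hbdd : ∃ b : ℤ, ∀ n : ℤ, a (μ₀ + n / h) ≠ 0 → b ≤ n := by
    obtain ⟨B, hB⟩ := hfin.bddBelow
    -- `B` only bounds the negative exponents in the support; the minimum with `0` takes care of the
    -- others.
    refine ⟨⌊min 0 B * h - μ₀ * h⌋, fun n hn => ?_⟩
    have h1 : min 0 B ≤ μ₀ + n / h := by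
      by_cases h0 : μ₀ + n / h < 0
      · exact (min_le_right _ _).trans (hB ⟨hr ▸ ⟨n, rfl⟩, h0, hn⟩)
      · exact (min_le_left _ _).trans (not_lt.1 h0)
    have h2 : min 0 B * h - μ₀ * h ≤ n := by
      have := mul_le_mul_of_nonneg_right h1 hh.le
      rw [add_mul, div_mul_cancel₀ _ hh.ne'] at this
      linarith
    exact_mod_cast (Int.floor_le _).trans h2
  obtain ⟨n₀, hn₀, hmin⟩ := Int.exists_least_of_bdd hbdd hex
  have hpi := Real.pi_pos
  set R : ℝ := r + 1
  set c : ℤ → ℝ := fun n => ‖a (μ₀ + n / h)‖ * Real.exp (-(2 * Real.pi * (μ₀ + n / h) * R)) with hc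
  have hcs : Summable c := by
    have := (hs' (R * Complex.I) (by simp [R])).summable.norm
    simpa only [norm_mul, norm_expi, Complex.mul_I_im, Complex.ofReal_re] using this
  set μ₁ : ℝ := μ₀ + n₀ / h with hμ₁
  refine ⟨-μ₁, a μ₁, hn₀, 1 / h, by positivity,
    (∑' n, c n) * Real.exp (2 * Real.pi * (μ₁ + 1 / h) * R), R, fun z hz => ?_⟩
  have hz' : r < z.im := lt_of_lt_of_le (by simp [R]) hz
  have hsub := (hs' z hz').sub (hasSum_ite_eq n₀ (a μ₁ * expi μ₁ z))
  rw [neg_neg]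
  -- Absolute convergence at the fixed height `R` controls all higher `z`: every remaining exponent
  -- is at least `μ₁ + 1 / h`, so raising the height by `Im z - R` gains at least that rate of
  -- decay.
  have hbound : ∀ n : ℤ, ‖a (μ₀ + n / h) * expi (μ₀ + n / h) z -
      (if n = n₀ then a μ₁ * expi μ₁ z else 0)‖ ≤
      c n * Real.exp (-(2 * Real.pi * (μ₁ + 1 / h) * (z.im - R))) := by
    intro n
    split_ifs with hn
    · subst hn
      rw [sub_self, norm_zero]; positivity
    rw [sub_zero]
    by_cases h0 : a (μ₀ + n / h) = 0
    · rw [h0]; simp only [zero_mul, norm_zero]; positivity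
    have hlt : n₀ + 1 ≤ n := by have := hmin n h0; omega
    have hle : μ₁ + 1 / h ≤ μ₀ + n / h := by
      rw [hμ₁, add_assoc, ← add_div]
      gcongr
      exact_mod_cast hlt
    simp only [norm_mul, norm_expi, hc]
    rw [mul_assoc ‖_‖, ← Real.exp_add]
    gcongr
    nlinarith [mul_le_mul_of_nonneg_right hle (sub_nonneg.2 hz)]
  have := tsum_of_norm_bounded (hcs.mul_right _).hasSum hbound
  rw [hsub.tsum_eq, tsum_mul_right] at this
  refine this.trans (le_of_eq ?_)
  rw [mul_assoc (∑' n, c n), ← Real.exp_add]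
  congr 2
  ring

lemma HasLeadingTerm.tendsto_norm {g : ℂ → ℂ} {ν : ℝ} {A : ℂ} (hg : HasLeadingTerm g ν A) :
    Tendsto (fun y : ℝ => ‖g (y * Complex.I)‖ * Real.exp (-(2 * Real.pi * ν * y))) atTop
      (𝓝 ‖A‖) := by
  obtain ⟨ε, hε, C, R, h⟩ := hg
  have hpi := Real.pi_pos
  have h0 : Tendsto (fun y : ℝ => C * Real.exp (-(2 * Real.pi * ε * y))) atTop (𝓝 0) := by
    have h1 : Tendsto (fun y : ℝ => 2 * Real.pi * ε * y) atTop atTop :=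
      tendsto_id.const_mul_atTop (by positivity)
    simpa using (Real.tendsto_exp_neg_atTop_nhds_zero.comp h1).const_mul C
  rw [tendsto_iff_norm_sub_tendsto_zero]
  refine squeeze_zero' (Eventually.of_forall fun _ => norm_nonneg _) ?_ h0
  filter_upwards [eventually_ge_atTop R] with y hy
  have h1 := h (y * Complex.I) (by simpa using hy)
  have h2 := abs_norm_sub_norm_le (g (y * Complex.I)) (A * expi (-ν) (y * Complex.I))
  rw [norm_mul, norm_expi] at h2
  simp only [Complex.mul_I_im, Complex.ofReal_re] at h1 h2
  have h3 : ‖g (y * Complex.I)‖ * Real.exp (-(2 * Real.pi * ν * y)) - ‖A‖ =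
      (‖g (y * Complex.I)‖ - ‖A‖ * Real.exp (-(2 * Real.pi * -ν * y))) *
        Real.exp (-(2 * Real.pi * ν * y)) := by
    rw [sub_mul, mul_assoc ‖A‖, ← Real.exp_add]; ring_nf; simp
  rw [h3, norm_mul, Real.norm_eq_abs, Real.norm_eq_abs, Real.abs_exp]
  calc _ ≤ C * Real.exp (2 * Real.pi * (ν - ε) * y) * Real.exp (-(2 * Real.pi * ν * y)) := by
        gcongr; exact h2.trans h1
    _ = _ := by rw [mul_assoc, ← Real.exp_add]; ring_nf

/-- The growth exponent is determined by the absolute value. -/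
lemma HasLeadingTerm.exponent_le {g g' : ℂ → ℂ} {ν ν' : ℝ} {A A' : ℂ} (hA' : A' ≠ 0)
    (hg : HasLeadingTerm g ν A) (hg' : HasLeadingTerm g' ν' A')
    (heq : ∀ y : ℝ, 0 < y → ‖g (y * Complex.I)‖ = ‖g' (y * Complex.I)‖) : ν' ≤ ν := by
  by_contra! hlt
  have hpi := Real.pi_pos
  have h1 : Tendsto (fun y : ℝ => 2 * Real.pi * (ν' - ν) * y) atTop atTop :=
    tendsto_id.const_mul_atTop (by have := sub_pos.2 hlt; positivity)
  have h2 := hg.tendsto_norm.mul (Real.tendsto_exp_neg_atTop_nhds_zero.comp h1)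
  rw [mul_zero] at h2
  have h3 : ‖A'‖ = 0 := by
    refine tendsto_nhds_unique hg'.tendsto_norm (h2.congr' ?_)
    filter_upwards [eventually_gt_atTop 0] with y hy
    rw [heq y hy, mul_assoc]
    simp only [Function.comp]
    rw [← Real.exp_add]
    ring_nf
  exact hA' (norm_eq_zero.1 h3)

/-! ### The Möbius action and reduction theory -/

lemma mem_halfPlane {r : ℝ} {z : ℂ} : z ∈ halfPlane r ↔ r < z.im := Iff.rfl

lemma isOpen_halfPlane (r : ℝ) : IsOpen (halfPlane r) :=
  isOpen_lt continuous_const Complex.continuous_im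

lemma isPreconnected_halfPlane (r : ℝ) : IsPreconnected (halfPlane r) :=
  (convex_halfSpace_im_gt r).isPreconnected

lemma det_entries (γ : SL(2, ℤ)) :
    (γ 0 0 : ℂ) * (γ 1 1 : ℂ) - (γ 0 1 : ℂ) * (γ 1 0 : ℂ) = 1 := by
  have := γ.det_coe
  rw [Matrix.det_fin_two] at this
  exact_mod_cast this

lemma autDenom_ne_zero (γ : SL(2, ℤ)) {z : ℂ} (hz : 0 < z.im) : autDenom γ z ≠ 0 := by
  intro h
  have hd := det_entries γ
  have him := congrArg Complex.im h
  simp only [autDenom, Complex.add_im, Complex.mul_im, Complex.intCast_re, Complex.intCast_im,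
    zero_mul, add_zero, Complex.zero_im, mul_eq_zero, hz.ne', or_false] at him
  have hc : (γ 1 0 : ℂ) = 0 := by exact_mod_cast him
  rw [autDenom, hc, zero_mul, zero_add] at h
  rw [hc, h] at hd
  simp at hd

lemma autDenom_mul (γ δ : SL(2, ℤ)) {z : ℂ} (hz : 0 < z.im) :
    autDenom (γ * δ) z = autDenom γ (moebius δ z) * autDenom δ z := by
  have h := autDenom_ne_zero δ hz
  rw [autDenom, autDenom, moebius]
  rw [add_mul, mul_assoc, div_mul_cancel₀ _ h, autDenom]
  simp only [Matrix.SpecialLinearGroup.coe_mul, Matrix.mul_apply, Fin.sum_univ_two]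
  push_cast; ring

lemma moebius_im (γ : SL(2, ℤ)) (z : ℂ) :
    (moebius γ z).im = z.im / ‖autDenom γ z‖ ^ 2 := by
  have hd := γ.det_coe
  rw [Matrix.det_fin_two] at hd
  have hd' : (γ 0 0 : ℝ) * (γ 1 1 : ℝ) - (γ 0 1 : ℝ) * (γ 1 0 : ℝ) = 1 := by exact_mod_cast hd
  rw [moebius, Complex.div_im, Complex.normSq_eq_norm_sq, ← sub_div]
  congr 1
  simp only [autDenom, Complex.add_im, Complex.mul_im, Complex.intCast_re, Complex.intCast_im,
    Complex.add_re, Complex.mul_re]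
  linear_combination z.im * hd'

lemma moebius_im_pos (γ : SL(2, ℤ)) {z : ℂ} (hz : 0 < z.im) : 0 < (moebius γ z).im := by
  rw [moebius_im]
  have := norm_pos_iff.2 (autDenom_ne_zero γ hz)
  positivity

lemma moebius_mul (γ δ : SL(2, ℤ)) {z : ℂ} (hz : 0 < z.im) :
    moebius (γ * δ) z = moebius γ (moebius δ z) := by
  have h := autDenom_ne_zero δ hz
  have h' := autDenom_ne_zero γ (moebius_im_pos δ hz)
  rw [moebius.eq_1 (γ * δ), autDenom_mul γ δ hz, moebius.eq_1 γ,
    div_eq_div_iff (mul_ne_zero h' h) h']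
  rw [mul_comm (autDenom γ _) (autDenom δ z), ← mul_assoc]
  congr 1
  rw [add_mul, moebius, mul_assoc, div_mul_cancel₀ _ h, autDenom]
  simp only [Matrix.SpecialLinearGroup.coe_mul, Matrix.mul_apply, Fin.sum_univ_two]
  push_cast; ring

lemma autDenom_one (z : ℂ) : autDenom 1 z = 1 := by simp [autDenom]

lemma moebius_one (z : ℂ) : moebius 1 z = z := by simp [moebius, autDenom_one]

lemma moebius_moebius_inv (γ : SL(2, ℤ)) {z : ℂ} (hz : 0 < z.im) :
    moebius γ (moebius γ⁻¹ z) = z := by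
  rw [← moebius_mul _ _ hz, mul_inv_cancel, moebius_one]

lemma autDenom_inv (γ : SL(2, ℤ)) (z : ℂ) : autDenom γ⁻¹ z = γ 0 0 - γ 1 0 * z := by
  rw [autDenom, Matrix.SpecialLinearGroup.SL2_inv_expl]
  simp; ring

lemma autDenom_moebius_inv (γ : SL(2, ℤ)) {z : ℂ} (hz : 0 < z.im) :
    autDenom γ (moebius γ⁻¹ z) * (γ 0 0 - γ 1 0 * z) = 1 := by
  rw [← autDenom_inv, ← autDenom_mul _ _ hz, mul_inv_cancel, autDenom_one]

lemma moebius_inv_im (γ : SL(2, ℤ)) (z : ℂ) :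
    (moebius γ⁻¹ z).im = z.im / ‖(γ 0 0 - γ 1 0 * z : ℂ)‖ ^ 2 := by
  rw [moebius_im, autDenom_inv]

lemma norm_sub_mul_sq (γ : SL(2, ℤ)) (hc : γ 1 0 ≠ 0) (z : ℂ) :
    ‖(γ 0 0 - γ 1 0 * z : ℂ)‖ ^ 2 =
      (γ 1 0 : ℝ) ^ 2 * ((z.re - (γ 0 0 : ℝ) / γ 1 0) ^ 2 + z.im ^ 2) := by
  have hc' : (γ 1 0 : ℝ) ≠ 0 := by exact_mod_cast hc
  rw [← Complex.normSq_eq_norm_sq, Complex.normSq_apply]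
  simp only [Complex.sub_re, Complex.mul_re, Complex.intCast_re, Complex.intCast_im, Complex.sub_im,
    Complex.mul_im]
  field_simp
  ring

lemma moebius_inv_im' (γ : SL(2, ℤ)) (hc : γ 1 0 ≠ 0) (z : ℂ) :
    (moebius γ⁻¹ z).im =
      z.im / ((γ 1 0 : ℝ) ^ 2 * ((z.re - (γ 0 0 : ℝ) / γ 1 0) ^ 2 + z.im ^ 2)) := by
  rw [moebius_inv_im, norm_sub_mul_sq γ hc]

/-- In terms of `w = z - a/c`, one has `γ⁻¹ z = -d/c - 1/(c² w)`. -/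
lemma moebius_inv_eq (γ : SL(2, ℤ)) (hc : γ 1 0 ≠ 0) {z : ℂ} (hz : 0 < z.im) :
    moebius γ⁻¹ z = ((-(γ 1 1 : ℝ) / γ 1 0 : ℝ) : ℂ) +
      ((1 / (γ 1 0 : ℝ) ^ 2 : ℝ) : ℂ) * (-1 / (z - ((γ 0 0 : ℝ) / γ 1 0 : ℝ))) := by
  have hc' : (γ 1 0 : ℂ) ≠ 0 := by exact_mod_cast hc
  have h := autDenom_moebius_inv γ hz
  have h1 : (γ 0 0 - γ 1 0 * z : ℂ) ≠ 0 := by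
    intro h0; rw [h0] at h; simp at h
  have h2 : z - ((γ 0 0 : ℝ) / γ 1 0 : ℝ) = -(γ 0 0 - γ 1 0 * z : ℂ) / γ 1 0 := by
    push_cast; field_simp; ring
  rw [h2]
  rw [autDenom] at h
  push_cast
  field_simp
  linear_combination h

lemma moebius_T_pow (n : ℕ) (z : ℂ) : moebius (ModularGroup.T ^ n) z = z + n := by
  have h := ModularGroup.coe_T_zpow n
  rw [zpow_natCast] at h
  simp [moebius, autDenom, h]

lemma autDenom_T_pow (n : ℕ) (z : ℂ) : autDenom (ModularGroup.T ^ n) z = 1 := by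
  have h := ModularGroup.coe_T_zpow n
  rw [zpow_natCast] at h
  simp [autDenom, h]

lemma exists_moebius_eq_of_im_pos {z : ℂ} (hz : 0 < z.im) :
    ∃ γ : SL(2, ℤ), |(moebius γ⁻¹ z).re| ≤ 1 / 2 ∧ 1 / 2 ≤ (moebius γ⁻¹ z).im := by
  obtain ⟨g, hg⟩ := ModularGroup.exists_smul_mem_fd ⟨z, hz⟩
  refine ⟨g⁻¹, ?_⟩
  have key : moebius g⁻¹⁻¹ z = ((g • (⟨z, hz⟩ : UpperHalfPlane) : UpperHalfPlane) : ℂ) := by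
    rw [inv_inv, UpperHalfPlane.specialLinearGroup_apply]
    simp [moebius, autDenom]
  rw [key]
  set τ : UpperHalfPlane := g • (⟨z, hz⟩ : UpperHalfPlane) with hτ
  have h1 : |τ.re| ≤ 1 / 2 := hg.2
  have h2 : 1 ≤ τ.re * τ.re + τ.im * τ.im := by
    have h3 : 1 ≤ Complex.normSq τ := hg.1
    rwa [Complex.normSq_apply] at h3
  have h5 := τ.im_pos
  refine ⟨h1, ?_⟩
  change 1 / 2 ≤ τ.im
  have h6 := abs_le.1 h1
  nlinarith

/-! ### Growth of `f` at the cusps -/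

/-- The function `z ↦ (cz + d)^{-k} f (γ z)`. -/
noncomputable def slash (k : ℝ) (f : ℂ → ℂ) (γ : SL(2, ℤ)) (z : ℂ) : ℂ :=
  autDenom γ z ^ (-k : ℂ) * f (moebius γ z)

lemma slash_one (k : ℝ) (f : ℂ → ℂ) : slash k f 1 = f := by
  ext z; simp [slash, autDenom_one, moebius_one]

lemma norm_slash (k : ℝ) (f : ℂ → ℂ) (γ : SL(2, ℤ)) (z : ℂ) :
    ‖slash k f γ z‖ = ‖autDenom γ z‖ ^ (-k) * ‖f (moebius γ z)‖ := by
  rw [slash, norm_mul, ← Complex.ofReal_neg, Complex.norm_cpow_real]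

/-- The modulus of the automorphy factor cancels the power of the denominator exactly. Only absolute
values are compared, so neither the branch of the power nor the argument of `j` plays a role. -/
lemma IsModularFunction.norm_slash_mul {Γ : Subgroup SL(2, ℤ)} {k : ℝ} {f : ℂ → ℂ}
    (hf : IsModularFunction Γ k f) {δ : SL(2, ℤ)} (hδ : δ ∈ Γ) (γ : SL(2, ℤ)) {z : ℂ}
    (hz : 0 < z.im) : ‖slash k f (δ * γ) z‖ = ‖slash k f γ z‖ := by
  obtain ⟨j, -, hj, hfj⟩ := hf.automorphy δ hδ
  have hz' := moebius_im_pos γ hz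
  have h0 := norm_pos_iff.2 (autDenom_ne_zero δ hz')
  rw [norm_slash, norm_slash, moebius_mul _ _ hz, hfj _ hz', norm_mul, hj _ hz',
    autDenom_mul _ _ hz, norm_mul, Real.mul_rpow (norm_nonneg _) (norm_nonneg _)]
  have : ‖autDenom δ (moebius γ z)‖ ^ (-k) * ‖autDenom δ (moebius γ z)‖ ^ k = 1 := by
    rw [← Real.rpow_add h0]; simp
  linear_combination (‖autDenom γ z‖ ^ (-k) * ‖f (moebius γ z)‖) * this

lemma norm_eq_norm_slash (k : ℝ) (f : ℂ → ℂ) (γ : SL(2, ℤ)) {z : ℂ} (hz : 0 < z.im) :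
    ‖f z‖ = ‖(γ 0 0 - γ 1 0 * z : ℂ)‖ ^ (-k) * ‖slash k f γ (moebius γ⁻¹ z)‖ := by
  have h := autDenom_moebius_inv γ hz
  rw [norm_slash, moebius_moebius_inv γ hz, ← mul_assoc,
    ← Real.mul_rpow (norm_nonneg _) (norm_nonneg _), ← norm_mul, mul_comm, mul_comm _ (autDenom _ _),
    h]
  simp

lemma differentiableOn_moebius (γ : SL(2, ℤ)) : DifferentiableOn ℂ (moebius γ) (halfPlane 0) := by
  intro z hz
  have : autDenom γ z ≠ 0 := autDenom_ne_zero γ hz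
  unfold moebius
  unfold autDenom at *
  exact DifferentiableAt.differentiableWithinAt (by fun_prop (disch := assumption))

lemma differentiableOn_comp_moebius {f : ℂ → ℂ} (hol : DifferentiableOn ℂ f (halfPlane 0))
    (γ : SL(2, ℤ)) : DifferentiableOn ℂ (fun z => f (moebius γ z)) (halfPlane 0) :=
  hol.comp (differentiableOn_moebius γ) fun _ hz => moebius_im_pos γ hz

/-- Identity theorem: vanishing high up would make `f ∘ γ` vanish on the whole upper half plane, and
`γ` maps that half plane onto itself. -/
lemma exists_slash_ne_zero {f : ℂ → ℂ} (hne : ∃ z ∈ halfPlane 0, f z ≠ 0)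
    (hol : DifferentiableOn ℂ f (halfPlane 0)) (k : ℝ) (γ : SL(2, ℤ)) (R : ℝ) :
    ∃ z : ℂ, R < z.im ∧ slash k f γ z ≠ 0 := by
  by_contra! hcon
  obtain ⟨z₀, hz₀, hfz₀⟩ := hne
  have han := (differentiableOn_comp_moebius hol γ).analyticOnNhd (isOpen_halfPlane 0)
  set w : ℂ := ((max R 0 + 1 : ℝ) : ℂ) * Complex.I with hw
  have hwim : w.im = max R 0 + 1 := by simp [hw]
  have hw0 : 0 < w.im := by rw [hwim]; positivity
  have hwR : R < w.im := by rw [hwim]; linarith [le_max_left R 0]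
  have hev : (fun z => f (moebius γ z)) =ᶠ[𝓝 w] 0 := by
    filter_upwards [(isOpen_halfPlane R).mem_nhds hwR, (isOpen_halfPlane 0).mem_nhds hw0]
      with z hzR hz0
    have h1 := hcon z hzR
    rw [slash, mul_eq_zero] at h1
    rcases h1 with h1 | h1
    · exact absurd (Complex.cpow_eq_zero_iff _ _ |>.1 h1).1 (autDenom_ne_zero γ hz0)
    · exact h1
  have h2 := han.eqOn_zero_of_preconnected_of_eventuallyEq_zero (isPreconnected_halfPlane 0)
    (z₀ := w) hw0 hev (moebius_im_pos γ⁻¹ hz₀)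
  simp only [moebius_moebius_inv γ hz₀] at h2
  exact hfz₀ h2

/-- The leading term gives the bound above height `R`; below it, the strip of width one is compact.
-/
lemma HasLeadingTerm.exists_norm_slash_le {k ν : ℝ} {f : ℂ → ℂ} {γ : SL(2, ℤ)} {A : ℂ}
    (h : HasLeadingTerm (slash k f γ) ν A) (hol : DifferentiableOn ℂ f (halfPlane 0)) :
    ∃ C : ℝ, ∀ z : ℂ, |z.re| ≤ 1 / 2 → 1 / 2 ≤ z.im →
      ‖slash k f γ z‖ ≤ C * Real.exp (2 * Real.pi * ν * z.im) := by
  obtain ⟨ε, hε, C, R, hR⟩ := h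
  have hpi := Real.pi_pos
  set S : Set ℂ := Set.Icc (-(1 / 2)) (1 / 2) ×ℂ Set.Icc (1 / 2) R with hS
  have hScomp : IsCompact S := isCompact_Icc.reProdIm isCompact_Icc
  have hS0 : S ⊆ halfPlane 0 := fun z hz => by
    have := hz.2.1
    rw [mem_halfPlane]; linarith
  have hcont : ContinuousOn (fun z : ℂ => ‖autDenom γ z‖ ^ (-k) * ‖f (moebius γ z)‖ *
      Real.exp (-(2 * Real.pi * ν * z.im))) S := by
    refine ContinuousOn.mul (ContinuousOn.mul (ContinuousOn.rpow_const ?_ ?_) ?_) ?_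
    · unfold autDenom; fun_prop
    · exact fun z hz => Or.inl (norm_ne_zero_iff.2 (autDenom_ne_zero γ (hS0 hz)))
    · exact ((differentiableOn_comp_moebius hol γ).continuousOn.mono hS0).norm
    · fun_prop
  obtain ⟨B, hB⟩ := hScomp.exists_bound_of_continuousOn hcont
  refine ⟨max B (|C| + ‖A‖), fun z hz1 hz2 => ?_⟩
  rcases le_total R z.im with hz | hz
  · have h1 := hR z hz
    have h2 : ‖slash k f γ z‖ ≤ ‖slash k f γ z - A * expi (-ν) z‖ + ‖A * expi (-ν) z‖ := by
      simpa using norm_add_le (slash k f γ z - A * expi (-ν) z) (A * expi (-ν) z)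
    rw [norm_mul, norm_expi] at h2
    have h3 : -(2 * Real.pi * -ν * z.im) = 2 * Real.pi * ν * z.im := by ring
    rw [h3] at h2
    have h4 : C * Real.exp (2 * Real.pi * (ν - ε) * z.im) ≤
        |C| * Real.exp (2 * Real.pi * ν * z.im) := by
      gcongr
      · exact le_abs_self C
      · linarith
    calc _ ≤ (|C| + ‖A‖) * Real.exp (2 * Real.pi * ν * z.im) := by linarith
      _ ≤ _ := by gcongr; exact le_max_right _ _
  · have h1 := hB z ⟨abs_le.1 hz1, hz2, hz⟩
    rw [← norm_slash, norm_mul, norm_norm, Real.norm_eq_abs, Real.abs_exp] at h1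
    calc _ = ‖slash k f γ z‖ * Real.exp (-(2 * Real.pi * ν * z.im)) *
          Real.exp (2 * Real.pi * ν * z.im) := by
          rw [mul_assoc, ← Real.exp_add]; simp
      _ ≤ _ := by gcongr; exact h1.trans (le_max_left _ _)

lemma Subgroup.exists_finite_right_transversal {G : Type*} [Group G] (Γ : Subgroup G)
    (hΓ : Γ.FiniteIndex) : ∃ T : Set G, T.Finite ∧ ∀ γ, ∃ δ ∈ Γ, ∃ t ∈ T, γ = δ * t := by
  have : Finite (G ⧸ Γ) := Subgroup.finite_quotient_of_finiteIndex
  refine ⟨Set.range fun q : G ⧸ Γ => q.out⁻¹, Set.finite_range _, fun γ => ?_⟩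
  refine ⟨γ * (QuotientGroup.mk (s := Γ) γ⁻¹).out, ?_, _, ⟨QuotientGroup.mk γ⁻¹, rfl⟩, by simp⟩
  have : QuotientGroup.mk (s := Γ) γ⁻¹ = ((QuotientGroup.mk (s := Γ) γ⁻¹).out : G) :=
    (QuotientGroup.out_eq' _).symm
  simpa using QuotientGroup.eq.1 this

/-- The bound on `f` in terms of growth exponents provided by reduction theory. -/
def IsGrowthBound (k : ℝ) (f : ℂ → ℂ) (ν : SL(2, ℤ) → ℝ) (K : ℝ) : Prop :=
  ∀ z : ℂ, 0 < z.im → ∃ γ : SL(2, ℤ), 1 / 2 ≤ (moebius γ⁻¹ z).im ∧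
    ‖f z‖ ≤ K * √(2 * z.im) ^ (-k) * Real.exp (2 * Real.pi * ν γ * (moebius γ⁻¹ z).im)

/-- The growth exponents of `f` at the cusps take finitely many values, and control the size
of `f` on the whole upper half plane. -/
lemma IsModularFunction.exists_growth_exponents {Γ : Subgroup SL(2, ℤ)} (hΓ : Γ.FiniteIndex)
    {k : ℝ} (hk : k < 0) {f : ℂ → ℂ} (hf : IsModularFunction Γ k f)
    (hne : ∃ z ∈ halfPlane 0, f z ≠ 0) (hol : DifferentiableOn ℂ f (halfPlane 0)) :
    ∃ ν : SL(2, ℤ) → ℝ, (∀ γ, ∃ A : ℂ, A ≠ 0 ∧ HasLeadingTerm (slash k f γ) (ν γ) A) ∧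
      (Set.range ν).Finite ∧ ∃ K : ℝ, 0 < K ∧ IsGrowthBound k f ν K := by
  have hlead : ∀ γ, ∃ ν : ℝ, ∃ A : ℂ, A ≠ 0 ∧ HasLeadingTerm (slash k f γ) ν A := fun γ =>
    (hf.finite_order γ).exists_hasLeadingTerm (exists_slash_ne_zero hne hol k γ)
  choose ν A hA hν using hlead
  -- The exponent is visible in absolute values alone, hence depends only on the coset `Γγ`; finite
  -- index leaves finitely many values and one constant for all cosets.
  have hinv : ∀ δ ∈ Γ, ∀ γ, ν (δ * γ) = ν γ := by
    intro δ hδ γ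
    have hnorm : ∀ y : ℝ, 0 < y → ‖slash k f (δ * γ) (y * Complex.I)‖ =
        ‖slash k f γ (y * Complex.I)‖ := fun y hy =>
      hf.norm_slash_mul hδ γ (by simpa using hy)
    exact le_antisymm ((hν γ).exponent_le (hA _) (hν _) fun y hy => (hnorm y hy).symm)
      ((hν (δ * γ)).exponent_le (hA _) (hν _) hnorm)
  obtain ⟨T, hT, hTΓ⟩ := Γ.exists_finite_right_transversal hΓ
  refine ⟨ν, fun γ => ⟨A γ, hA γ, hν γ⟩, (hT.image ν).subset ?_, ?_⟩
  · rintro _ ⟨γ, rfl⟩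
    obtain ⟨δ, hδ, t, ht, rfl⟩ := hTΓ γ
    exact ⟨t, ht, (hinv δ hδ t).symm⟩
  choose C hC using fun γ => (hν γ).exists_norm_slash_le hol
  obtain ⟨B, hB⟩ := (hT.image C).bddAbove
  refine ⟨max B 1, by positivity, fun z hz => ?_⟩
  obtain ⟨γ, hre, him⟩ := exists_moebius_eq_of_im_pos hz
  refine ⟨γ, him, ?_⟩
  have hz' := moebius_im_pos γ⁻¹ hz
  rw [norm_eq_norm_slash k f γ hz]
  have h1 : ‖slash k f γ (moebius γ⁻¹ z)‖ ≤
      max B 1 * Real.exp (2 * Real.pi * ν γ * (moebius γ⁻¹ z).im) := by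
    obtain ⟨δ, hδ, t, ht, hγ⟩ := hTΓ γ
    have h2 := hC t _ hre him
    rw [← hf.norm_slash_mul hδ t hz', ← hinv δ hδ t, ← hγ] at h2
    refine h2.trans ?_
    gcongr
    exact (hB ⟨t, ht, rfl⟩).trans (le_max_left _ _)
  -- The square of this norm is `Im z / Im (γ⁻¹ z)`, and the denominator is at least `1 / 2`. As `-k
  -- > 0`, the bound survives raising to that power.
  have h2 : ‖(γ 0 0 - γ 1 0 * z : ℂ)‖ ≤ √(2 * z.im) := by
    apply Real.le_sqrt_of_sq_le
    rw [moebius_inv_im, le_div_iff₀] at him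
    · linarith
    · rw [moebius_inv_im] at hz'
      exact (div_pos_iff_of_pos_left hz).1 hz'
  calc _ ≤ √(2 * z.im) ^ (-k) *
        (max B 1 * Real.exp (2 * Real.pi * ν γ * (moebius γ⁻¹ z).im)) := by
        gcongr
        linarith
    _ = _ := by ring

/-! ### Dominant cusps -/

/-- Since `ν` is bounded above, values `ν / c²` beyond a fixed positive threshold force `c` to be
bounded, so only finitely many such values occur. `M` is the largest and `M'` the next one, or the
threshold if there is none. -/
lemma exists_dominant_exponent {ν : SL(2, ℤ) → ℝ} (hν : (Set.range ν).Finite)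
    (hpos : ∃ γ : SL(2, ℤ), γ 1 0 ≠ 0 ∧ 0 < ν γ) :
    ∃ M M' : ℝ, 0 < M' ∧ M' < M ∧ (∃ γ : SL(2, ℤ), γ 1 0 ≠ 0 ∧ ν γ / (γ 1 0 : ℝ) ^ 2 = M) ∧
      (∀ γ : SL(2, ℤ), γ 1 0 ≠ 0 →
        ν γ / (γ 1 0 : ℝ) ^ 2 = M ∨ ν γ / (γ 1 0 : ℝ) ^ 2 ≤ M') ∧
      ∃ Q : ℕ, 0 < Q ∧ ∀ γ : SL(2, ℤ), γ 1 0 ≠ 0 → ν γ / (γ 1 0 : ℝ) ^ 2 = M →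
        γ 1 0 ∣ (Q : ℤ) := by
  obtain ⟨γ₀, hc₀, hν₀⟩ := hpos
  have hsq : ∀ γ : SL(2, ℤ), γ 1 0 ≠ 0 → 0 < (γ 1 0 : ℝ) ^ 2 := fun γ h => by
    have : (γ 1 0 : ℝ) ≠ 0 := by exact_mod_cast h
    positivity
  set s₀ : ℝ := ν γ₀ / (γ₀ 1 0 : ℝ) ^ 2 with hs₀
  have hs₀pos : 0 < s₀ := div_pos hν₀ (hsq _ hc₀)
  obtain ⟨V, hV⟩ := hν.bddAbove
  -- From `s₀ / 2 ≤ ν / c²` and `ν ≤ V` one gets `c² ≤ 2 V / s₀`; hence `|c| ≤ B`, and `B!` serves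
  -- as common multiple.
  set B : ℕ := ⌈2 * V / s₀⌉₊ with hB
  have hcB : ∀ γ : SL(2, ℤ), γ 1 0 ≠ 0 → s₀ / 2 ≤ ν γ / (γ 1 0 : ℝ) ^ 2 →
      (γ 1 0).natAbs ≤ B := by
    intro γ hc hs
    rw [le_div_iff₀ (hsq γ hc)] at hs
    have h1 : ν γ ≤ V := hV ⟨γ, rfl⟩
    have h2 : (γ 1 0 : ℝ) ^ 2 ≤ 2 * V / s₀ := by
      rw [le_div_iff₀ hs₀pos]; nlinarith
    have h3 : (((γ 1 0).natAbs ^ 2 : ℕ) : ℝ) ≤ B := by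
      refine le_trans ?_ (Nat.le_ceil _)
      rw [← Int.cast_natCast, Int.natCast_pow, Int.natAbs_sq]
      exact_mod_cast h2
    have h4 : (γ 1 0).natAbs ^ 2 ≤ B := by exact_mod_cast h3
    exact (Nat.le_self_pow two_ne_zero _).trans h4
  set F : Set ℝ := {s | s₀ / 2 ≤ s ∧ ∃ γ : SL(2, ℤ), γ 1 0 ≠ 0 ∧ ν γ / (γ 1 0 : ℝ) ^ 2 = s} with hF
  have hFfin : F.Finite := by
    refine (Set.Finite.image2 (fun (v : ℝ) (c : ℤ) => v / (c : ℝ) ^ 2) hν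
      (Set.finite_Icc (-(B : ℤ)) B)).subset ?_
    rintro s ⟨hs, γ, hc, rfl⟩
    have := hcB γ hc hs
    exact ⟨ν γ, ⟨γ, rfl⟩, γ 1 0, ⟨by omega, by omega⟩, rfl⟩
  have hs₀F : s₀ ∈ F := ⟨by linarith, γ₀, hc₀, rfl⟩
  obtain ⟨M, hMF, hM⟩ := Set.exists_max_image F id hFfin ⟨s₀, hs₀F⟩
  have hMs : s₀ ≤ M := hM s₀ hs₀F
  -- Inserting `s₀ / 2` keeps the set non-empty, makes `M'` positive, and covers all values below
  -- the threshold.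
  obtain ⟨M', hM'F, hM'⟩ := Set.exists_max_image (insert (s₀ / 2) (F \ {M})) id
    ((hFfin.sdiff).insert _) ⟨_, Set.mem_insert _ _⟩
  have hM's : s₀ / 2 ≤ M' := hM' _ (Set.mem_insert _ _)
  refine ⟨M, M', by linarith, ?_, hMF.2, ?_, B.factorial, B.factorial_pos, ?_⟩
  · rcases hM'F with h | h
    · linarith
    · exact lt_of_le_of_ne (hM M' h.1) h.2
  · intro γ hc
    by_cases h1 : s₀ / 2 ≤ ν γ / (γ 1 0 : ℝ) ^ 2
    · by_cases h2 : ν γ / (γ 1 0 : ℝ) ^ 2 = M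
      · exact Or.inl h2
      · exact Or.inr (hM' _ (Set.mem_insert_of_mem _ ⟨⟨h1, γ, hc, rfl⟩, h2⟩))
    · exact Or.inr (by linarith)
  · intro γ hc hγ
    have h1 := hcB γ hc (by rw [hγ]; linarith)
    rw [← Int.natAbs_dvd_natAbs, Int.natAbs_natCast]
    exact Nat.dvd_factorial (Int.natAbs_pos.2 hc) h1

/-! ### Laplace's method and the saddle point -/

lemma one_sub_I_mul_ne_zero (τ : ℝ) : (1 - Complex.I * τ : ℂ) ≠ 0 := by
  intro h
  have := congrArg Complex.re h
  simp at this

lemma re_sq_div_one_sub_I_mul (s τ : ℝ) :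
    ((s : ℂ) ^ 2 / (1 - Complex.I * τ)).re = s ^ 2 / (1 + τ ^ 2) := by
  have h1 : ((s : ℂ) ^ 2 / (1 - Complex.I * τ)) =
      ((s ^ 2 / (1 + τ ^ 2) : ℝ) : ℂ) * (1 + Complex.I * τ) := by
    have h2 : (1 + τ ^ 2 : ℂ) ≠ 0 := by
      have : (1 + τ ^ 2 : ℝ) ≠ 0 := by positivity
      exact_mod_cast this
    have h3 := one_sub_I_mul_ne_zero τ
    push_cast
    field_simp
    ring_nf
    simp
  rw [h1, Complex.re_ofReal_mul]
  simp

/-- Laplace's method for the phase `τ² / (1 - iτ)`. -/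
lemma tendsto_laplace_integral {ψ : ℝ → ℂ} (hψ : Continuous ψ) :
    Tendsto (fun R : ℝ => (R : ℂ) * ∫ τ in (-1 : ℝ)..1,
      ψ τ * Complex.exp (-((R * τ : ℝ) ^ 2 / (1 - Complex.I * τ)))) atTop
      (𝓝 (ψ 0 * (√Real.pi : ℝ))) := by
  obtain ⟨B, hB⟩ := (isCompact_Icc (a := (-1 : ℝ)) (b := 1)).exists_bound_of_continuousOn
    hψ.continuousOn
  have hcont : Continuous fun p : ℝ × ℝ =>
      ψ p.1 * Complex.exp (-((p.2 : ℂ) ^ 2 / (1 - Complex.I * p.1))) := by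
    refine (hψ.comp continuous_fst).mul (Complex.continuous_exp.comp (Continuous.neg ?_))
    exact Continuous.div (by fun_prop) (by fun_prop) fun p => one_sub_I_mul_ne_zero p.1
  set F : ℝ → ℝ → ℂ := fun R => (Set.Ioc (-R) R).indicator fun σ =>
    ψ (σ / R) * Complex.exp (-((σ : ℂ) ^ 2 / (1 - Complex.I * (σ / R : ℝ)))) with hF
  have hconv : ∀ R : ℝ, 0 < R → (R : ℂ) * ∫ τ in (-1 : ℝ)..1,
      ψ τ * Complex.exp (-((R * τ : ℝ) ^ 2 / (1 - Complex.I * τ))) = ∫ σ, F R σ := by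
    intro R hR
    have h1 := intervalIntegral.integral_comp_div (a := -R) (b := R) (c := R)
      (fun τ : ℝ => ψ τ * Complex.exp (-((R * τ : ℝ) ^ 2 / (1 - Complex.I * τ)))) hR.ne'
    rw [neg_div, div_self hR.ne', Complex.real_smul] at h1
    rw [← h1, hF, integral_indicator measurableSet_Ioc,
      intervalIntegral.integral_of_le (by linarith)]
    congr 1
    ext σ
    rw [mul_div_cancel₀ _ hR.ne']
  have hgauss : ∫ σ : ℝ, ψ 0 * ((Real.exp (-1 * σ ^ 2) : ℝ) : ℂ) = ψ 0 * (√Real.pi : ℝ) := by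
    rw [integral_const_mul, integral_complex_ofReal, integral_gaussian, div_one]
  rw [← hgauss]
  have hB0 : 0 ≤ B := (norm_nonneg _).trans (hB 0 (by simp))
  refine (tendsto_integral_filter_of_dominated_convergence
    (F := F) (fun σ => B * Real.exp (-(1 / 2) * σ ^ 2)) ?_ ?_ ?_ ?_).congr' ?_
  · filter_upwards [eventually_gt_atTop 0] with R hR
    refine Continuous.aestronglyMeasurable ?_ |>.indicator measurableSet_Ioc
    exact hcont.comp (by fun_prop : Continuous fun σ : ℝ => (σ / R, σ))
  · filter_upwards [eventually_gt_atTop 0] with R hR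
    refine Eventually.of_forall fun σ => ?_
    by_cases hσ : σ ∈ Set.Ioc (-R) R
    · rw [hF]
      simp only [Set.indicator_of_mem hσ]
      have hτ : σ / R ∈ Set.Icc (-1 : ℝ) 1 :=
        ⟨by rw [le_div_iff₀ hR]; linarith [hσ.1], by rw [div_le_iff₀ hR]; linarith [hσ.2]⟩
      rw [norm_mul, Complex.norm_exp, Complex.neg_re, re_sq_div_one_sub_I_mul]
      gcongr
      · exact hB _ hτ
      -- On `|τ| ≤ 1` the real part `σ² / (1 + τ²)` of the phase is at least `σ² / 2`, which
      -- supplies a Gaussian majorant independent of `R`.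
      · have h1 : (σ / R) ^ 2 ≤ 1 := (sq_le_one_iff_abs_le_one _).2 (abs_le.2 hτ)
        have h2 : σ ^ 2 / 2 ≤ σ ^ 2 / (1 + (σ / R) ^ 2) := by
          gcongr; linarith
        linarith
    · rw [hF]
      simp only [Set.indicator_of_notMem hσ, norm_zero]
      positivity
  · exact (integrable_exp_neg_mul_sq (by norm_num)).const_mul B
  · refine Eventually.of_forall fun σ => ?_
    have h0 : Tendsto (fun R : ℝ => (σ / R, σ)) atTop (𝓝 ((0 : ℝ), σ)) :=
      (tendsto_const_nhds.div_atTop tendsto_id).prodMk_nhds tendsto_const_nhds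
    have h1 := (hcont.tendsto ((0 : ℝ), σ)).comp h0
    have h2 : ψ 0 * ((Real.exp (-1 * σ ^ 2) : ℝ) : ℂ) =
        ψ 0 * Complex.exp (-((σ : ℂ) ^ 2 / (1 - Complex.I * (0 : ℝ)))) := by
      push_cast; simp
    rw [h2]
    refine h1.congr' ?_
    filter_upwards [eventually_gt_atTop |σ|] with R hR
    have := abs_lt.1 hR
    rw [hF]
    simp only [Set.indicator_of_mem (show σ ∈ Set.Ioc (-R) R from ⟨this.1, this.2.le⟩)]
    rfl
  · filter_upwards [eventually_gt_atTop 0] with R hR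
    exact (hconv R hR).symm

/-- The model `(-1/w)^k e^{2πiM/w}` of a modular form at a dominant cusp. -/
noncomputable def cuspModel (k M : ℝ) (w : ℂ) : ℂ := (-1 / w) ^ (k : ℂ) * expi (-M) (-1 / w)

/-- The weight normalizing the integrals of `cuspModel`. -/
noncomputable def saddleWeight (k M y : ℝ) : ℝ :=
  y ^ (k - 3 / 2) * Real.exp (-(4 * Real.pi * M / y))

lemma neg_one_div_im (w : ℂ) : (-1 / w).im = w.im / ‖w‖ ^ 2 := by
  rw [Complex.div_im, Complex.normSq_eq_norm_sq]
  simp [neg_div]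

lemma neg_one_div_im_pos {w : ℂ} (hw : 0 < w.im) : 0 < (-1 / w).im := by
  have : 0 < ‖w‖ := norm_pos_iff.2 (by rintro rfl; simp at hw)
  rw [neg_one_div_im]
  positivity

lemma ofReal_mul_cpow {r : ℝ} (hr : 0 < r) {x : ℂ} (hx : x ≠ 0) (s : ℂ) :
    ((r : ℂ) * x) ^ s = (r : ℂ) ^ s * x ^ s := by
  have hrC : (r : ℂ) ≠ 0 := by exact_mod_cast hr.ne'
  rw [Complex.cpow_def_of_ne_zero (mul_ne_zero hrC hx), Complex.cpow_def_of_ne_zero hrC,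
    Complex.cpow_def_of_ne_zero hx, Complex.log_ofReal_mul hr hx, Complex.ofReal_log hr.le, add_mul,
    Complex.exp_add]

lemma continuousAt_cuspModel (k M : ℝ) {w : ℂ} (hw : 0 < w.im) :
    ContinuousAt (cuspModel k M) w := by
  have hw0 : w ≠ 0 := by rintro rfl; simp at hw
  have h1 : ContinuousAt (fun w : ℂ => -1 / w) w := by fun_prop (disch := assumption)
  exact (h1.cpow continuousAt_const (Or.inr (neg_one_div_im_pos hw).ne')).mul
    ((continuous_expi _).continuousAt.comp h1)

/-- With frequency `M / y²` the phase `M / w - M w / y²` is stationary at `w = i y`, where the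
exponential equals `exp (4πM/y)`. Scaling by `y` puts the deviation from this value exactly into the
form `τ² / (1 - iτ)`, with large parameter `2πM / y`. -/
lemma cuspModel_mul_expi (k M : ℝ) {y : ℝ} (hy : 0 < y) (τ : ℝ) :
    cuspModel k M (y * (τ + Complex.I)) * expi (-(M / y ^ 2)) (y * (τ + Complex.I)) =
      (y ^ (-k) * Real.exp (4 * Real.pi * M / y) : ℝ) * ((-1 / (τ + Complex.I)) ^ (k : ℂ) *
        Complex.exp (-((2 * Real.pi * M / y : ℝ) * τ ^ 2 / (1 - Complex.I * τ)))) := by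
  have hyC : (y : ℂ) ≠ 0 := by exact_mod_cast hy.ne'
  have hs : (τ + Complex.I : ℂ) = Complex.I * (1 - Complex.I * τ) := by
    ring_nf; simp
  have h0 := one_sub_I_mul_ne_zero τ
  have hI := Complex.I_ne_zero
  have hpow : (-1 / (y * (τ + Complex.I)) : ℂ) ^ (k : ℂ) =
      (y ^ (-k) : ℝ) * (-1 / (τ + Complex.I)) ^ (k : ℂ) := by
    have h1 : (-1 / (y * (τ + Complex.I)) : ℂ) = ((y⁻¹ : ℝ) : ℂ) * (-1 / (τ + Complex.I)) := by
      push_cast; rw [hs]; field_simp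
    have h2 : (-1 / (τ + Complex.I) : ℂ) ≠ 0 := by
      rw [hs]; exact div_ne_zero (by simp) (mul_ne_zero hI h0)
    rw [h1, ofReal_mul_cpow (by positivity) h2, ← Complex.ofReal_cpow (by positivity),
      Real.inv_rpow hy.le, Real.rpow_neg hy.le]
  rw [cuspModel, hpow, expi, expi]
  push_cast
  have hexp : Complex.exp (2 * Real.pi * Complex.I * -M * (-1 / (y * (τ + Complex.I)))) *
      Complex.exp (2 * Real.pi * Complex.I * (-(M / y ^ 2)) * (y * (τ + Complex.I))) =
      Complex.exp (4 * Real.pi * M / y) *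
        Complex.exp (-(2 * Real.pi * M / y * τ ^ 2 / (1 - Complex.I * τ))) := by
    rw [← Complex.exp_add, ← Complex.exp_add]
    congr 1
    rw [hs]
    field_simp
    ring_nf
    simp
    ring
  linear_combination ((y ^ (-k) : ℝ) * (-1 / (τ + Complex.I) : ℂ) ^ (k : ℂ)) * hexp

lemma exists_tendsto_integral_cuspModel (k : ℝ) {M : ℝ} (hM : 0 < M) :
    ∃ κ : ℂ, κ ≠ 0 ∧ Tendsto (fun y : ℝ => (saddleWeight k M y : ℂ) * ∫ t in (-y)..y,
      cuspModel k M (t + y * Complex.I) * expi (-(M / y ^ 2)) (t + y * Complex.I))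
      (𝓝[>] 0) (𝓝 κ) := by
  have hpi := Real.pi_pos
  set ψ : ℝ → ℂ := fun τ => (-1 / (τ + Complex.I)) ^ (k : ℂ) with hψ
  have him : ∀ τ : ℝ, 0 < (τ + Complex.I : ℂ).im := by intro τ; simp
  have hψc : Continuous ψ := by
    refine continuous_iff_continuousAt.2 fun τ => ?_
    have h0 : (τ + Complex.I : ℂ) ≠ 0 := fun h => by
      have := him τ; rw [h] at this; simp at this
    refine ContinuousAt.cpow (by fun_prop (disch := assumption)) continuousAt_const
      (Or.inr (neg_one_div_im_pos (him τ)).ne')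
  have hlim : Tendsto (fun y : ℝ => √(2 * Real.pi * M / y)) (𝓝[>] 0) atTop := by
    refine Real.tendsto_sqrt_atTop.comp ?_
    exact (tendsto_inv_nhdsGT_zero.const_mul_atTop (by positivity : 0 < 2 * Real.pi * M))
  have hL := ((tendsto_laplace_integral hψc).comp hlim).const_mul
    (((√(2 * Real.pi * M))⁻¹ : ℝ) : ℂ)
  refine ⟨_, ?_, hL.congr' ?_⟩
  · refine mul_ne_zero ?_ (mul_ne_zero ?_ ?_)
    · rw [Complex.ofReal_ne_zero]; positivity
    · rw [hψ]
      simp only [Complex.ofReal_zero, zero_add]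
      rw [Ne, Complex.cpow_eq_zero_iff]
      simp
    · rw [Complex.ofReal_ne_zero]; positivity
  · filter_upwards [self_mem_nhdsWithin] with y hy
    have hy : 0 < y := hy
    have hyC : (y : ℂ) ≠ 0 := by exact_mod_cast hy.ne'
    have h1 := intervalIntegral.integral_comp_div (a := -y) (b := y) (c := y)
      (fun τ : ℝ => cuspModel k M (y * (τ + Complex.I)) *
        expi (-(M / y ^ 2)) (y * (τ + Complex.I))) hy.ne'
    rw [neg_div, div_self hy.ne', Complex.real_smul] at h1
    have h2 : ∀ t : ℝ, (y * (((t / y : ℝ) : ℂ) + Complex.I) : ℂ) = t + y * Complex.I := by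
      intro t; push_cast; field_simp
    simp_rw [h2] at h1
    rw [h1]
    simp_rw [cuspModel_mul_expi k M hy]
    rw [intervalIntegral.integral_const_mul]
    simp only [Function.comp]
    set R := √(2 * Real.pi * M / y) with hR
    have hR2 : R ^ 2 = 2 * Real.pi * M / y := Real.sq_sqrt (by positivity)
    have h3 : ∀ τ : ℝ, ((R * τ : ℝ) ^ 2 : ℂ) = (2 * Real.pi * M / y : ℝ) * τ ^ 2 := by
      intro τ; rw [← hR2]; push_cast; ring
    simp_rw [h3]
    rw [← mul_assoc, ← mul_assoc, ← mul_assoc]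
    congr 1
    have h4 : (√(2 * Real.pi * M))⁻¹ * R =
        saddleWeight k M y * y * (y ^ (-k) * Real.exp (4 * Real.pi * M / y)) := by
      rw [hR, Real.sqrt_div (by positivity), saddleWeight]
      have h5 : Real.exp (-(4 * Real.pi * M / y)) * Real.exp (4 * Real.pi * M / y) = 1 := by
        rw [← Real.exp_add]; simp
      have h6 : y ^ (k - 3 / 2) * y * y ^ (-k) = (√y)⁻¹ := by
        nth_rewrite 2 [← Real.rpow_one y]
        rw [← Real.rpow_add hy, ← Real.rpow_add hy, Real.sqrt_eq_rpow, ← Real.rpow_neg hy.le]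
        congr 1; ring
      have h7 : √(2 * Real.pi * M) ≠ 0 := by positivity
      calc _ = (√y)⁻¹ := by field_simp
        _ = y ^ (k - 3 / 2) * y * y ^ (-k) *
            (Real.exp (-(4 * Real.pi * M / y)) * Real.exp (4 * Real.pi * M / y)) := by
            rw [h5, h6, mul_one]
        _ = _ := by ring
    exact_mod_cast h4

/-- The second exponential is the size of `expi (-(M / y²))` at height `y`. The product is a power
of `y` times `exp (-2π(M - M₁)/y)`, so any error of exponent below `M` is negligible. -/
lemma tendsto_saddleWeight_mul_exp (k : ℝ) {M M₁ : ℝ} (h : M₁ < M) :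
    Tendsto (fun y : ℝ => saddleWeight k M y *
      (Real.exp (2 * Real.pi * M₁ / y) * Real.exp (2 * Real.pi * M / y))) (𝓝[>] 0) (𝓝 0) := by
  have hpi := Real.pi_pos
  have hb : 0 < 2 * Real.pi * (M - M₁) := by have := sub_pos.2 h; positivity
  refine ((tendsto_rpow_mul_exp_neg_mul_atTop_nhds_zero (3 / 2 - k) _ hb).comp
    tendsto_inv_nhdsGT_zero).congr' ?_
  filter_upwards [self_mem_nhdsWithin] with y hy
  have hy : 0 < y := hy
  simp only [Function.comp]
  rw [saddleWeight, Real.inv_rpow hy.le, ← Real.rpow_neg hy.le, mul_assoc (y ^ (k - 3 / 2)),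
    ← Real.exp_add, ← Real.exp_add]
  congr 2
  · ring
  · field_simp; ring

/-- If `f` is close to a multiple of `cuspModel` for `|t| ≤ y` and small elsewhere, then its
integrals are asymptotic to those of the model. -/
lemma tendsto_integral_of_close_cuspModel {k M δ : ℝ} {κ : ℂ} (hδ : 0 < δ)
    (hκ : Tendsto (fun y : ℝ => (saddleWeight k M y : ℂ) * ∫ t in (-y)..y,
      cuspModel k M (t + y * Complex.I) * expi (-(M / y ^ 2)) (t + y * Complex.I))
      (𝓝[>] 0) (𝓝 κ)) {F : ℂ → ℂ} (hF : ContinuousOn F (halfPlane 0)) {C : ℂ} {M₁ K : ℝ}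
    (hM₁ : M₁ < M)
    (hclose : ∀ᶠ y : ℝ in 𝓝[>] 0, ∀ t : ℝ, |t| ≤ δ →
      (|t| ≤ y → ‖F (t + y * Complex.I) - C * cuspModel k M (t + y * Complex.I)‖ ≤
        K * Real.exp (2 * Real.pi * M₁ / y)) ∧
      (y ≤ |t| → ‖F (t + y * Complex.I)‖ ≤ K * Real.exp (2 * Real.pi * M₁ / y))) :
    Tendsto (fun y : ℝ => (saddleWeight k M y : ℂ) * ∫ t in (-δ)..δ,
      F (t + y * Complex.I) * expi (-(M / y ^ 2)) (t + y * Complex.I))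
      (𝓝[>] 0) (𝓝 (C * κ)) := by
  have herr := (tendsto_saddleWeight_mul_exp k hM₁).const_mul (K * (3 * (2 * δ)))
  rw [mul_zero] at herr
  refine (hκ.const_mul C).congr_dist (squeeze_zero' (Eventually.of_forall fun _ => dist_nonneg) ?_
    herr)
  have hyδ : ∀ᶠ y : ℝ in 𝓝[>] 0, y < δ := nhdsWithin_le_nhds (eventually_lt_nhds hδ)
  filter_upwards [hclose, hyδ, self_mem_nhdsWithin] with y hy hyδ hy0
  have hy0 : 0 < y := hy0
  -- The sign of `K` is not assumed; it is read off from the bound at `t = δ`, which applies once `y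
  -- < δ`.
  have hK : 0 ≤ K * Real.exp (2 * Real.pi * M₁ / y) :=
    (norm_nonneg _).trans ((hy δ (abs_of_pos hδ).le).2 (by rw [abs_of_pos hδ]; exact hyδ.le))
  have him : ∀ t : ℝ, 0 < (t + y * Complex.I : ℂ).im := by intro t; simpa using hy0
  have hline : Continuous fun t : ℝ => (t + y * Complex.I : ℂ) := by fun_prop
  have hFc : Continuous fun t : ℝ =>
      F (t + y * Complex.I) * expi (-(M / y ^ 2)) (t + y * Complex.I) :=
    (hF.comp_continuous hline him).mul (by fun_prop)
  have hGc : Continuous fun t : ℝ =>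
      cuspModel k M (t + y * Complex.I) * expi (-(M / y ^ 2)) (t + y * Complex.I) :=
    (continuous_iff_continuousAt.2 fun t =>
      ContinuousAt.comp (f := fun t : ℝ => (t + y * Complex.I : ℂ))
        (continuousAt_cuspModel k M (him t)) hline.continuousAt).mul (by fun_prop)
  have hexp : ∀ t : ℝ, ‖expi (-(M / y ^ 2)) (t + y * Complex.I)‖ =
      Real.exp (2 * Real.pi * M / y) := by
    intro t
    rw [norm_expi]
    congr 1
    simp
    field_simp
  set E := K * Real.exp (2 * Real.pi * M₁ / y) * Real.exp (2 * Real.pi * M / y) with hE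
  have hE0 : 0 ≤ E := by positivity
  have h1 : ‖∫ t in (-δ)..(-y), F (t + y * Complex.I) *
      expi (-(M / y ^ 2)) (t + y * Complex.I)‖ ≤ E * (2 * δ) := by
    refine (intervalIntegral.norm_integral_le_of_norm_le_const (C := E) fun t ht => ?_).trans ?_
    · rw [Set.uIoc_of_le (by linarith)] at ht
      have : |t| = -t := abs_of_neg (by linarith [ht.2])
      rw [norm_mul, hexp, hE]
      gcongr
      exact (hy t (by rw [this]; linarith [ht.1])).2 (by rw [this]; linarith [ht.2])
    · gcongr
      rw [abs_of_nonneg (by linarith)]; linarith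
  have h2 : ‖∫ t in y..δ, F (t + y * Complex.I) *
      expi (-(M / y ^ 2)) (t + y * Complex.I)‖ ≤ E * (2 * δ) := by
    refine (intervalIntegral.norm_integral_le_of_norm_le_const (C := E) fun t ht => ?_).trans ?_
    · rw [Set.uIoc_of_le (by linarith)] at ht
      have : |t| = t := abs_of_pos (by linarith [ht.1])
      rw [norm_mul, hexp, hE]
      gcongr
      exact (hy t (by rw [this]; linarith [ht.2])).2 (by rw [this]; linarith [ht.1])
    · gcongr
      rw [abs_of_nonneg (by linarith)]; linarith
  have h3 : ‖∫ t in (-y)..y, (F (t + y * Complex.I) *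
      expi (-(M / y ^ 2)) (t + y * Complex.I) - C * (cuspModel k M (t + y * Complex.I) *
      expi (-(M / y ^ 2)) (t + y * Complex.I)))‖ ≤ E * (2 * δ) := by
    refine (intervalIntegral.norm_integral_le_of_norm_le_const (C := E) fun t ht => ?_).trans ?_
    · rw [Set.uIoc_of_le (by linarith)] at ht
      have : |t| ≤ y := abs_le.2 ⟨ht.1.le, ht.2⟩
      rw [← mul_assoc, ← sub_mul, norm_mul, hexp, hE]
      gcongr
      exact (hy t (by linarith)).1 this
    · gcongr
      rw [abs_of_nonneg (by linarith)]; linarith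
  rw [intervalIntegral.integral_sub (hFc.intervalIntegrable _ _)
    ((hGc.intervalIntegrable _ _).const_mul C), intervalIntegral.integral_const_mul] at h3
  rw [← intervalIntegral.integral_add_adjacent_intervals (hFc.intervalIntegrable (-δ) (-y))
    (hFc.intervalIntegrable (-y) δ), ← intervalIntegral.integral_add_adjacent_intervals
    (hFc.intervalIntegrable (-y) y) (hFc.intervalIntegrable y δ)]
  have hW : 0 ≤ saddleWeight k M y := by unfold saddleWeight; positivity
  rw [dist_comm, dist_eq_norm]
  set I₁ := ∫ t in (-δ)..(-y), F (t + y * Complex.I) * expi (-(M / y ^ 2)) (t + y * Complex.I)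
  set I₂ := ∫ t in (-y)..y, F (t + y * Complex.I) * expi (-(M / y ^ 2)) (t + y * Complex.I)
  set I₃ := ∫ t in y..δ, F (t + y * Complex.I) * expi (-(M / y ^ 2)) (t + y * Complex.I)
  set J := ∫ t in (-y)..y, cuspModel k M (t + y * Complex.I) *
    expi (-(M / y ^ 2)) (t + y * Complex.I)
  have h4 : (saddleWeight k M y : ℂ) * (I₁ + (I₂ + I₃)) - C * (saddleWeight k M y * J) =
      saddleWeight k M y * (I₁ + (I₂ - C * J) + I₃) := by ring
  rw [h4, norm_mul, Complex.norm_real, Real.norm_of_nonneg hW]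
  calc _ ≤ saddleWeight k M y * (E * (2 * δ) + E * (2 * δ) + E * (2 * δ)) := by
        gcongr; exact norm_add₃_le.trans (add_le_add (add_le_add h1 h3) h2)
    _ = _ := by rw [hE]; ring

/-! ### Local behaviour of `f` near the real line -/

/-- On the upper half plane, multiplication by a negative real shifts the principal argument by a
constant, so the power still factors. This is needed because the lower left entry `c` may be
negative. -/
lemma exists_ofReal_mul_cpow_eq {r : ℝ} (hr : r ≠ 0) (s : ℂ) :
    ∃ B : ℂ, B ≠ 0 ∧ ∀ ζ : ℂ, 0 < ζ.im → ((r : ℂ) * ζ) ^ s = B * ζ ^ s := by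
  have hpos : ∀ r : ℝ, 0 < r → (r : ℂ) ^ s ≠ 0 := fun r hr => by
    rw [Ne, Complex.cpow_eq_zero_iff]
    simp [hr.ne']
  have hne : ∀ ζ : ℂ, 0 < ζ.im → ζ ≠ 0 := by rintro ζ hζ rfl; simp at hζ
  rcases hr.lt_or_gt with h | h
  · refine ⟨((-r : ℝ) : ℂ) ^ s * Complex.exp (-(Real.pi * Complex.I) * s),
      mul_ne_zero (hpos _ (by linarith)) (Complex.exp_ne_zero _), fun ζ hζ => ?_⟩
    have h1 : ((r : ℂ) * ζ) = ((-r : ℝ) : ℂ) * (-ζ) := by push_cast; ring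
    have h2 : Complex.log (-ζ) = -(Real.pi * Complex.I) + Complex.log ζ := by
      rw [Complex.log, Complex.log, norm_neg, Complex.arg_neg_eq_arg_sub_pi_of_im_pos hζ]
      push_cast; ring
    rw [h1, ofReal_mul_cpow (by linarith) (neg_ne_zero.2 (hne ζ hζ)), mul_assoc,
      Complex.cpow_def_of_ne_zero (neg_ne_zero.2 (hne ζ hζ)),
      Complex.cpow_def_of_ne_zero (hne ζ hζ), h2, add_mul, Complex.exp_add]
  · exact ⟨(r : ℂ) ^ s, hpos r h, fun ζ hζ => ofReal_mul_cpow h (hne ζ hζ) s⟩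

/-- If `c = 0`, then `γ⁻¹` is a translation and preserves the imaginary part. -/
lemma lower_left_ne_zero {γ : SL(2, ℤ)} {z : ℂ} (hz : z.im < 1 / 2)
    (h : 1 / 2 ≤ (moebius γ⁻¹ z).im) : γ 1 0 ≠ 0 := by
  intro hc
  have hd := γ.det_coe
  rw [Matrix.det_fin_two, hc, mul_zero, sub_zero] at hd
  rw [moebius_inv_im, hc] at h
  have h1 : (γ 0 0) ^ 2 = 1 := by
    rcases Int.isUnit_iff.1 (IsUnit.of_mul_eq_one _ hd) with h | h <;> rw [h] <;> norm_num
  have h2 : ‖((γ 0 0 : ℤ) : ℂ)‖ ^ 2 = 1 := by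
    rw [Complex.norm_intCast, sq_abs]; exact_mod_cast h1
  simp only [Int.cast_zero, zero_mul, sub_zero, h2, div_one] at h
  linarith

lemma IsGrowthBound.norm_le_of_nonpos {k : ℝ} {f : ℂ → ℂ} {ν : SL(2, ℤ) → ℝ} {K : ℝ} (hK : 0 < K)
    (hb : IsGrowthBound k f ν K) (hν : ∀ γ : SL(2, ℤ), γ 1 0 ≠ 0 → ν γ ≤ 0) {z : ℂ}
    (hz : 0 < z.im) (hz' : z.im < 1 / 2) : ‖f z‖ ≤ K * √(2 * z.im) ^ (-k) := by
  obtain ⟨γ, h1, h2⟩ := hb z hz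
  have hν' := hν γ (lower_left_ne_zero hz' h1)
  refine h2.trans (mul_le_of_le_one_right (by positivity) (Real.exp_le_one_iff.2 ?_))
  have hpi := Real.pi_pos
  exact mul_nonpos_of_nonpos_of_nonneg (mul_nonpos_of_nonneg_of_nonpos (by positivity) hν')
    (by linarith)

/-- Away from the dominant cusps, `f` is small. -/
lemma IsGrowthBound.exists_norm_le_exp {k : ℝ} (hk : k < 0) {f : ℂ → ℂ} {ν : SL(2, ℤ) → ℝ} {K : ℝ}
    (hK : 0 < K) (hb : IsGrowthBound k f ν K) {M M' : ℝ} (hM' : 0 < M') (hM : M' < M)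
    (hν : ∀ γ : SL(2, ℤ), γ 1 0 ≠ 0 →
      ν γ / (γ 1 0 : ℝ) ^ 2 = M ∨ ν γ / (γ 1 0 : ℝ) ^ 2 ≤ M') :
    ∃ M₁ < M, ∀ z : ℂ, 0 < z.im → z.im < 1 / 2 →
      (∀ γ : SL(2, ℤ), γ 1 0 ≠ 0 → ν γ / (γ 1 0 : ℝ) ^ 2 = M →
        z.im ≤ |z.re - (γ 0 0 : ℝ) / γ 1 0|) →
      ‖f z‖ ≤ K * Real.exp (2 * Real.pi * M₁ / z.im) := by
  have hpi := Real.pi_pos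
  -- Non-dominant cusps contribute at most `M' / y`. At a dominant cusp, distance `|t| ≥ y` gives `M
  -- y / (t² + y²) ≤ (M / 2) / y`.
  refine ⟨max M' (M / 2), max_lt hM (by linarith), fun z hz hz' hfar => ?_⟩
  obtain ⟨γ, h1, h2⟩ := hb z hz
  have hc := lower_left_ne_zero hz' h1
  have hcR : (γ 1 0 : ℝ) ≠ 0 := by exact_mod_cast hc
  set y := z.im with hy
  set t := z.re - (γ 0 0 : ℝ) / γ 1 0 with ht
  have hq : ν γ * (moebius γ⁻¹ z).im = ν γ / (γ 1 0 : ℝ) ^ 2 * (y / (t ^ 2 + y ^ 2)) := by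
    rw [moebius_inv_im' γ hc, ← hy, ← ht]
    have : t ^ 2 + y ^ 2 ≠ 0 := by positivity
    field_simp
  have hmain : ν γ * (moebius γ⁻¹ z).im ≤ max M' (M / 2) / y := by
    rw [hq]
    rcases hν γ hc with h | h
    · have h3 := hfar γ hc h
      have h4 : y ^ 2 ≤ t ^ 2 := by
        rw [← sq_abs t]; gcongr
      rw [h]
      calc M * (y / (t ^ 2 + y ^ 2)) ≤ M * (y / (y ^ 2 + y ^ 2)) := by
            gcongr
            linarith
        _ = M / 2 / y := by field_simp; ring
        _ ≤ _ := by gcongr; exact le_max_right _ _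
    · calc _ ≤ M' * (y / (t ^ 2 + y ^ 2)) := by gcongr
        _ ≤ M' * (y / (0 + y ^ 2)) := by gcongr; positivity
        _ = M' / y := by field_simp; ring
        _ ≤ _ := by gcongr; exact le_max_left _ _
  have hsqrt : √(2 * y) ^ (-k) ≤ 1 := by
    refine Real.rpow_le_one (by positivity) ?_ (by linarith)
    exact Real.sqrt_le_iff.2 ⟨zero_le_one, by linarith⟩
  calc ‖f z‖ ≤ K * √(2 * y) ^ (-k) * Real.exp (2 * Real.pi * ν γ * (moebius γ⁻¹ z).im) := h2
    _ ≤ K * 1 * Real.exp (2 * Real.pi * max M' (M / 2) / y) := by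
        gcongr
        rw [mul_assoc, mul_div_assoc]
        gcongr
    _ = _ := by ring

/-- Near a cusp with positive growth exponent, `f` is close to a multiple of `cuspModel`. -/
lemma HasLeadingTerm.exists_close_cuspModel {k : ℝ} (hk : k < 0) {f : ℂ → ℂ} {γ : SL(2, ℤ)}
    (hc : γ 1 0 ≠ 0) {ν : ℝ} {A : ℂ} (hA : A ≠ 0) (h : HasLeadingTerm (slash k f γ) ν A) {M : ℝ}
    (hM : ν / (γ 1 0 : ℝ) ^ 2 = M) (hM0 : 0 < M) :
    ∃ C : ℂ, C ≠ 0 ∧ ∃ M₁ < M, ∃ K : ℝ, ∀ᶠ y : ℝ in 𝓝[>] 0, ∀ z : ℂ, z.im = y →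
      |z.re - (γ 0 0 : ℝ) / γ 1 0| ≤ y →
      ‖f z - C * cuspModel k M (z - ((γ 0 0 : ℝ) / γ 1 0 : ℝ))‖ ≤
        K * Real.exp (2 * Real.pi * M₁ / y) := by
  obtain ⟨ε, hε, C₀, R, hR⟩ := h
  have hpi := Real.pi_pos
  have hcR : (γ 1 0 : ℝ) ≠ 0 := by exact_mod_cast hc
  have hcC : (γ 1 0 : ℂ) ≠ 0 := by exact_mod_cast hc
  have hν : ν = M * (γ 1 0 : ℝ) ^ 2 := by rw [← hM]; field_simp
  obtain ⟨B, hB, hBζ⟩ := exists_ofReal_mul_cpow_eq (one_div_ne_zero hcR) (k : ℂ)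
  set b : ℝ := -(γ 1 1 : ℝ) / γ 1 0 with hb
  -- The error exponent, divided by `c²`, is `M - ε / c²`. Truncating at `0` allows `y / (t² + y²)`
  -- to be replaced by its upper bound `1 / y`.
  set M₁ : ℝ := max (M - ε / (γ 1 0 : ℝ) ^ 2) 0 with hM₁
  refine ⟨B * A * expi (-ν) b, mul_ne_zero (mul_ne_zero hB hA) (expi_ne_zero _ _), M₁,
    max_lt (sub_lt_self _ (by positivity)) hM0, ‖B‖ * |C₀|, ?_⟩
  -- For `|t| ≤ y` one has `Im (γ⁻¹ z) ≥ 1 / (2c²y)`; this threshold pushes it above `R`, where the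
  -- leading term is valid.
  have hev : ∀ᶠ y : ℝ in 𝓝[>] 0, y < 1 / (2 * (γ 1 0 : ℝ) ^ 2 * max R 1) :=
    nhdsWithin_le_nhds (eventually_lt_nhds (by positivity))
  have hev' : ∀ᶠ y : ℝ in 𝓝[>] 0, y < 1 / 2 :=
    nhdsWithin_le_nhds (eventually_lt_nhds (by positivity))
  filter_upwards [hev, hev', self_mem_nhdsWithin] with y hy hy' hy0
  intro z hzy hzt
  have hy0 : 0 < y := hy0
  have hz : 0 < z.im := by rw [hzy]; exact hy0
  set w : ℂ := z - ((γ 0 0 : ℝ) / γ 1 0 : ℝ) with hw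
  set t : ℝ := z.re - (γ 0 0 : ℝ) / γ 1 0 with ht
  have hwim : w.im = y := by rw [hw, Complex.sub_im, Complex.ofReal_im, sub_zero, hzy]
  have hwre : w.re = t := by rw [hw, Complex.sub_re, Complex.ofReal_re]
  have hw0 : w ≠ 0 := by rintro h0; rw [h0] at hwim; simp at hwim; linarith
  set ζ : ℂ := -1 / w with hζ
  have hζim : 0 < ζ.im := neg_one_div_im_pos (by rw [hwim]; exact hy0)
  have hz' : moebius γ⁻¹ z = (b : ℂ) + ((1 / (γ 1 0 : ℝ) ^ 2 : ℝ) : ℂ) * ζ :=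
    moebius_inv_eq γ hc hz
  have ht2 : t ^ 2 ≤ y ^ 2 := by rw [← sq_abs t]; gcongr
  have hq : (moebius γ⁻¹ z).im = 1 / (γ 1 0 : ℝ) ^ 2 * (y / (t ^ 2 + y ^ 2)) := by
    rw [moebius_inv_im' γ hc, hzy, ← ht]
    have : t ^ 2 + y ^ 2 ≠ 0 := by positivity
    field_simp
  have hqle : y / (t ^ 2 + y ^ 2) ≤ 1 / y := by
    rw [div_le_div_iff₀ (by positivity) hy0]; nlinarith [sq_nonneg t]
  have hqge : 1 / (2 * y) ≤ y / (t ^ 2 + y ^ 2) := by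
    rw [div_le_div_iff₀ (by positivity) (by positivity)]; nlinarith
  have hRle : R ≤ (moebius γ⁻¹ z).im := by
    rw [hq]
    calc R ≤ max R 1 := le_max_left _ _
      _ ≤ 1 / (γ 1 0 : ℝ) ^ 2 * (1 / (2 * y)) := by
        rw [lt_div_iff₀ (by positivity)] at hy
        rw [div_mul_div_comm, le_div_iff₀ (by positivity)]
        linarith
      _ ≤ _ := by gcongr
  have happrox := hR _ hRle
  have haut : autDenom γ (moebius γ⁻¹ z) = ((1 / (γ 1 0 : ℝ) : ℝ) : ℂ) * ζ := by
    have h1 := autDenom_moebius_inv γ hz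
    have h2 : (γ 0 0 - γ 1 0 * z : ℂ) = -(γ 1 0 : ℂ) * w := by
      rw [hw]; push_cast; field_simp; ring
    rw [h2] at h1
    rw [eq_div_of_mul_eq (mul_ne_zero (neg_ne_zero.2 hcC) hw0) h1, hζ]
    push_cast
    field_simp
  have hfz : f z = B * ζ ^ (k : ℂ) * slash k f γ (moebius γ⁻¹ z) := by
    rw [← hBζ ζ hζim, ← haut, slash, moebius_moebius_inv γ hz, ← mul_assoc,
      ← Complex.cpow_add _ _ (autDenom_ne_zero γ (moebius_im_pos γ⁻¹ hz))]
    simp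
  have hexp : expi (-ν) (moebius γ⁻¹ z) = expi (-ν) b * expi (-M) ζ := by
    rw [hz', expi_add_right]
    congr 1
    rw [expi, expi, hν]
    congr 1
    push_cast
    field_simp
  have hdiff : f z - B * A * expi (-ν) b * cuspModel k M w = B * ζ ^ (k : ℂ) *
      (slash k f γ (moebius γ⁻¹ z) - A * expi (-ν) (moebius γ⁻¹ z)) := by
    rw [hfz, hexp, cuspModel]; ring
  have hwn : ‖w‖ ≤ 1 := by
    rw [← sq_le_one_iff₀ (norm_nonneg _), ← Complex.normSq_eq_norm_sq, Complex.normSq_apply, hwre,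
      hwim]
    nlinarith
  have hζn : ‖ζ‖ ^ k ≤ 1 := by
    rw [hζ, norm_div, norm_neg, norm_one, one_div, Real.inv_rpow (norm_nonneg _),
      ← Real.rpow_neg (norm_nonneg _)]
    exact Real.rpow_le_one (norm_nonneg _) hwn (by linarith)
  rw [hdiff, norm_mul, norm_mul, Complex.norm_cpow_real]
  have hexpo : (ν - ε) * (moebius γ⁻¹ z).im ≤ M₁ / y := by
    have h1 : (ν - ε) * (moebius γ⁻¹ z).im =
        (M - ε / (γ 1 0 : ℝ) ^ 2) * (y / (t ^ 2 + y ^ 2)) := by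
      rw [hq, hν]
      have : t ^ 2 + y ^ 2 ≠ 0 := by positivity
      field_simp
    rw [h1]
    calc _ ≤ M₁ * (y / (t ^ 2 + y ^ 2)) := by gcongr; exact le_max_left _ _
      _ ≤ M₁ * (1 / y) := by gcongr
      _ = _ := by ring
  calc _ ≤ ‖B‖ * 1 * (|C₀| * Real.exp (2 * Real.pi * M₁ / y)) := by
        gcongr
        refine happrox.trans ?_
        gcongr
        · exact le_abs_self _
        · rw [mul_assoc, mul_div_assoc]
          gcongr
    _ = _ := by ring

/-- The asymptotics of the integral of `f` over a segment centered at `j / Q`, where `Q` is a common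
denominator of the dominant cusps. -/
lemma exists_tendsto_local_integral {k : ℝ} (hk : k < 0) {f : ℂ → ℂ}
    (hol : DifferentiableOn ℂ f (halfPlane 0)) {ν : SL(2, ℤ) → ℝ}
    (hlead : ∀ γ, ∃ A : ℂ, A ≠ 0 ∧ HasLeadingTerm (slash k f γ) (ν γ) A) {K : ℝ}
    (hK : 0 < K) (hb : IsGrowthBound k f ν K) {M M' : ℝ} (hM' : 0 < M') (hM : M' < M)
    (hν : ∀ γ : SL(2, ℤ), γ 1 0 ≠ 0 →
      ν γ / (γ 1 0 : ℝ) ^ 2 = M ∨ ν γ / (γ 1 0 : ℝ) ^ 2 ≤ M')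
    {Q : ℕ} (hQ : 0 < Q) (hdvd : ∀ γ : SL(2, ℤ), γ 1 0 ≠ 0 → ν γ / (γ 1 0 : ℝ) ^ 2 = M →
        γ 1 0 ∣ (Q : ℤ)) {κ : ℂ}
    (hκ : Tendsto (fun y : ℝ => (saddleWeight k M y : ℂ) * ∫ t in (-y)..y,
      cuspModel k M (t + y * Complex.I) * expi (-(M / y ^ 2)) (t + y * Complex.I))
      (𝓝[>] 0) (𝓝 κ)) (j : ℤ) :
    ∃ C : ℂ, ((∃ γ : SL(2, ℤ), γ 1 0 ≠ 0 ∧ ν γ / (γ 1 0 : ℝ) ^ 2 = M ∧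
        (γ 0 0 : ℝ) / γ 1 0 = j / Q) → C ≠ 0) ∧
      Tendsto (fun y : ℝ => (saddleWeight k M y : ℂ) * ∫ t in (-(1 / (2 * Q) : ℝ))..(1 / (2 * Q)),
        f ((j / Q : ℝ) + (t + y * Complex.I)) * expi (-(M / y ^ 2)) (t + y * Complex.I))
      (𝓝[>] 0) (𝓝 (C * κ)) := by
  have hQR : (0 : ℝ) < Q := by exact_mod_cast hQ
  set p : ℝ := j / Q with hp
  set δ : ℝ := 1 / (2 * Q) with hδ
  have hδ0 : 0 < δ := by positivity
  obtain ⟨M₁, hM₁, hfar⟩ := hb.exists_norm_le_exp hk hK hM' hM hν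
  have hpi := Real.pi_pos
  have hFc : ContinuousOn (fun w : ℂ => f (p + w)) (halfPlane 0) :=
    hol.continuousOn.comp (by fun_prop) fun w hw => by
      simpa [mem_halfPlane] using hw
  -- Dominant cusps lie in `(1/Q)ℤ`, and distinct points there are at least `1 / Q = 2 * δ` apart.
  -- So a segment of radius `δ` about `j / Q` stays at distance at least `δ` from all the others.
  have hsep : ∀ γ : SL(2, ℤ), γ 1 0 ≠ 0 → ν γ / (γ 1 0 : ℝ) ^ 2 = M →
      (γ 0 0 : ℝ) / γ 1 0 = p ∨ 2 * δ ≤ |p - (γ 0 0 : ℝ) / γ 1 0| := by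
    intro γ hc hγ
    obtain ⟨e, he⟩ := hdvd γ hc hγ
    have hcR : (γ 1 0 : ℝ) ≠ 0 := by exact_mod_cast hc
    have heR : (Q : ℝ) = γ 1 0 * e := by exact_mod_cast he
    have h1 : (γ 0 0 : ℝ) / γ 1 0 = (γ 0 0 * e : ℤ) / Q := by
      have : (e : ℝ) ≠ 0 := by rintro h0; rw [h0, mul_zero] at heR; linarith
      rw [heR]; push_cast; field_simp
    rw [h1, hp, ← sub_div, abs_div, abs_of_pos hQR]
    by_cases hj : γ 0 0 * e = j
    · left; rw [hj]
    · right
      have h2 : (1 : ℤ) ≤ |j - γ 0 0 * e| := Int.one_le_abs (sub_ne_zero.2 (Ne.symm hj))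
      have h3 : (1 : ℝ) ≤ |(j : ℝ) - (γ 0 0 * e : ℤ)| := by exact_mod_cast h2
      rw [hδ]
      field_simp
      exact h3
  have hδev : ∀ᶠ y : ℝ in 𝓝[>] 0, y < min δ (1 / 2) :=
    nhdsWithin_le_nhds (eventually_lt_nhds (by positivity))
  have hpre : ∀ t y : ℝ, ((p : ℂ) + (t + y * Complex.I)).re = p + t := by intro t y; simp
  have hpim : ∀ t y : ℝ, ((p : ℂ) + (t + y * Complex.I)).im = y := by intro t y; simp
  have hother : ∀ y t : ℝ, y < min δ (1 / 2) → |t| ≤ δ → ∀ γ : SL(2, ℤ), γ 1 0 ≠ 0 →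
      ν γ / (γ 1 0 : ℝ) ^ 2 = M → (γ 0 0 : ℝ) / γ 1 0 ≠ p →
      y ≤ |p + t - (γ 0 0 : ℝ) / γ 1 0| := by
    intro y t hy ht γ hc hγ hne
    have h1 := (hsep γ hc hγ).resolve_left hne
    have h2 : |p - (γ 0 0 : ℝ) / γ 1 0| ≤ |p + t - (γ 0 0 : ℝ) / γ 1 0| + |t| := by
      have := abs_sub (p + t - (γ 0 0 : ℝ) / γ 1 0) t
      rwa [show p + t - (γ 0 0 : ℝ) / γ 1 0 - t = p - (γ 0 0 : ℝ) / γ 1 0 by ring] at this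
    have := hy.le.trans (min_le_left _ _)
    linarith
  by_cases hD : ∃ γ : SL(2, ℤ), γ 1 0 ≠ 0 ∧ ν γ / (γ 1 0 : ℝ) ^ 2 = M ∧ (γ 0 0 : ℝ) / γ 1 0 = p
  · obtain ⟨γ, hc, hγ, hγp⟩ := hD
    obtain ⟨A, hA, hAlead⟩ := hlead γ
    obtain ⟨C, hC, M₂, hM₂, K₂, hnear⟩ :=
      hAlead.exists_close_cuspModel hk hc hA hγ (hM'.trans hM)
    refine ⟨C, fun _ => hC, tendsto_integral_of_close_cuspModel hδ0 hκ hFc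
      (max_lt hM₁ hM₂) (K := max K K₂) ?_⟩
    filter_upwards [hδev, hnear, self_mem_nhdsWithin] with y hy hnear hy0 t ht
    have hy0 : 0 < y := hy0
    have hy2 := lt_of_lt_of_le hy (min_le_right _ _)
    refine ⟨fun hty => ?_, fun hty => ?_⟩
    · have h1 := hnear ((p : ℂ) + (t + y * Complex.I)) (hpim t y) (by
        rw [hpre, hγp, add_sub_cancel_left]; exact hty)
      rw [hγp, add_sub_cancel_left] at h1
      refine h1.trans ?_
      gcongr
      · exact le_max_right _ _
      · exact le_max_right _ _
    · have h1 := hfar ((p : ℂ) + (t + y * Complex.I)) (by rw [hpim]; exact hy0)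
        (by rw [hpim]; exact hy2) (fun γ' hc' hγ' => by
          rw [hpim, hpre]
          by_cases h2 : (γ' 0 0 : ℝ) / γ' 1 0 = p
          · rw [h2, add_sub_cancel_left]; exact hty
          · exact hother y t hy ht γ' hc' hγ' h2)
      rw [hpim] at h1
      refine h1.trans ?_
      gcongr
      · exact le_max_left _ _
      · exact le_max_left _ _
  · refine ⟨0, fun h => absurd h hD, tendsto_integral_of_close_cuspModel hδ0 hκ hFc hM₁
      (K := K) ?_⟩
    filter_upwards [hδev, self_mem_nhdsWithin] with y hy hy0 t ht
    have hy0 : 0 < y := hy0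
    have hy2 := lt_of_lt_of_le hy (min_le_right _ _)
    have h1 := hfar ((p : ℂ) + (t + y * Complex.I)) (by rw [hpim]; exact hy0)
        (by rw [hpim]; exact hy2) (fun γ' hc' hγ' => by
          rw [hpim, hpre]
          exact hother y t hy ht γ' hc' hγ' fun h2 => hD ⟨γ', hc', hγ', h2⟩)
    rw [hpim] at h1
    exact ⟨fun _ => by simpa using h1, fun _ => h1⟩

/-! ### Periods and contour integrals for the coefficients -/

/-- Some power of `T` lies in `Γ`. Its automorphy factor has modulus one everywhere, so it is
constant by the maximum principle. -/
lemma IsModularFunction.exists_period {Γ : Subgroup SL(2, ℤ)} (hΓ : Γ.FiniteIndex) {k : ℝ}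
    {f : ℂ → ℂ} (hf : IsModularFunction Γ k f) :
    ∃ N : ℕ, 0 < N ∧ ∃ u : ℂ, ‖u‖ = 1 ∧ ∀ z : ℂ, 0 < z.im → f (z + N) = u * f z := by
  obtain ⟨N, hN, -, hNΓ⟩ := Subgroup.exists_pow_mem_of_index_ne_zero hΓ.index_ne_zero
    ModularGroup.T
  obtain ⟨j, hj, hjn, hfj⟩ := hf.automorphy _ hNΓ
  have hj1 : ∀ z ∈ halfPlane 0, ‖j z‖ = 1 := fun z hz => by
    rw [hjn z hz, autDenom_T_pow, norm_one, Real.one_rpow]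
  have hI : Complex.I ∈ halfPlane 0 := by simp [mem_halfPlane]
  have hconst := Complex.eqOn_of_isPreconnected_of_isMaxOn_norm (isPreconnected_halfPlane 0)
    (isOpen_halfPlane 0) hj hI fun z hz => by
      simp only [Set.mem_ofPred_eq, Function.comp, hj1 z hz, hj1 _ hI, le_refl]
  refine ⟨N, hN, j Complex.I, hj1 _ hI, fun z hz => ?_⟩
  rw [← moebius_T_pow, hfj z hz, hconst hz]
  rfl

/-- A function with an expansion at infinity has an expansion with respect to any of its
(quasi-)periods. -/
lemma IsExpansionAtInfty.exists_of_period {g : ℂ → ℂ} {h : ℝ} {u : ℂ} {a : ℝ → ℂ}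
    (hg : IsExpansionAtInfty g h u a) {h' : ℝ} (hh' : 0 < h') {u' : ℂ} (hu' : ‖u'‖ = 1) {R : ℝ}
    (hper : ∀ z : ℂ, R < z.im → g (z + h') = u' * g z) :
    ∃ a' : ℝ → ℂ, IsExpansionAtInfty g h' u' a' := by
  classical
  obtain ⟨hh, hu, r, hd, -, hs⟩ := hg
  obtain ⟨μ₀, hr⟩ := exists_expLattice_eq_range hh hu
  have hs' : ∀ z : ℂ, r < z.im →
      HasSum (fun n : ℤ => a (μ₀ + n / h) * expi (μ₀ + n / h) z) (g z) := fun z hz =>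
    (hasSum_expLattice_iff hh hr (fun μ => a μ * expi μ z) _).1 (hs z hz)
  set Y : ℝ := max r R + 1 with hY
  have hYr : r < Y := by linarith [le_max_left r R]
  have hYR : R < Y := by linarith [le_max_right r R]
  -- The expansion of `g (z + h') - u' * g z = 0` has these coefficients, and they vanish by
  -- uniqueness. So the support of `a` already lies in the lattice of the new period.
  have hzero : ∀ n : ℤ, a (μ₀ + n / h) * (expi (μ₀ + n / h) h' - u') = 0 := by
    intro n
    have hsum : ∀ x : ℝ, HasSum (fun n : ℤ => a (μ₀ + n / h) * (expi (μ₀ + n / h) h' - u') *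
        expi (μ₀ + n / h) (x + Y * Complex.I)) 0 := by
      intro x
      have him : (x + Y * Complex.I : ℂ).im = Y := by simp
      have h1 := hs' (x + Y * Complex.I + h') (by simpa using hYr)
      have h2 := (hs' (x + Y * Complex.I) (by simpa using hYr)).mul_left u'
      have h3 := h1.sub h2
      rw [hper _ (by rw [him]; exact hYR), sub_self] at h3
      refine h3.congr_fun ?_
      intro n
      rw [expi_add_right _ _ (h' : ℂ)]; ring
    have := integral_mul_expi_eq_coeff hh μ₀ _ (fun _ => 0) 0 Y hsum n
    simp only [zero_mul, intervalIntegral.integral_zero] at this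
    exact (mul_eq_zero.1 this.symm).resolve_left (by exact_mod_cast hh.ne')
  have hmem : ∀ μ ∈ expLattice h u, a μ ≠ 0 → μ ∈ expLattice h' u' := by
    intro μ hμ hne
    rw [hr] at hμ
    obtain ⟨n, rfl⟩ := hμ
    exact sub_eq_zero.1 ((mul_eq_zero.1 (hzero n)).resolve_left hne)
  refine ⟨fun μ => if μ ∈ expLattice h u then a μ else 0, hh', hu', max r R,
    hd.mono fun z hz => (le_max_left r R).trans_lt hz,
    fun z hz => hper z ((le_max_right r R).trans_lt hz), fun z hz => ?_⟩
  have h1 := hs z ((le_max_left r R).trans_lt hz)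
  set F : ℝ → ℂ := fun μ => (if μ ∈ expLattice h u then a μ else 0) * expi μ z with hF
  have h2 : HasSum (F ∘ ((↑) : expLattice h u → ℝ)) (g z) := by
    refine h1.congr_fun fun μ => ?_
    simp only [hF, Function.comp, if_pos μ.2]
    rfl
  rw [hasSum_subtype_iff_indicator] at h2
  change HasSum (F ∘ ((↑) : expLattice h' u' → ℝ)) (g z)
  rw [hasSum_subtype_iff_indicator]
  convert h2 using 1
  ext μ
  by_cases hμ : μ ∈ expLattice h u
  · by_cases ha : a μ = 0
    · simp [Set.indicator_apply, hF, ha]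
    · simp [hμ, hmem μ hμ ha]
  · simp [Set.indicator_apply, hμ, hF]

/-- The coefficients of the expansion at infinity of a function that is holomorphic and
quasi-periodic on the upper half plane, as integrals at an arbitrary height. -/
lemma IsExpansionAtInfty.integral_eq_coeff {f : ℂ → ℂ} {h : ℝ} {u : ℂ} {a : ℝ → ℂ}
    (hf : IsExpansionAtInfty f h u a) (hol : DifferentiableOn ℂ f (halfPlane 0))
    (hper : ∀ z : ℂ, 0 < z.im → f (z + h) = u * f z) {μ : ℝ} (hμ : μ ∈ expLattice h u) (x₀ : ℝ)
    {y : ℝ} (hy : 0 < y) :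
    ∫ x in x₀..(x₀ + h), f (x + y * Complex.I) * expi (-μ) (x + y * Complex.I) = h * a μ := by
  obtain ⟨hh, hu, r, -, -, hs⟩ := hf
  obtain ⟨μ₀, hr⟩ := exists_expLattice_eq_range hh hu
  set Y : ℝ := max r y + 1 with hY
  have hYr : r < Y := by linarith [le_max_left r y]
  have hYy : y < Y := by linarith [le_max_right r y]
  have htop : ∫ x in x₀..(x₀ + h), f (x + Y * Complex.I) * expi (-μ) (x + Y * Complex.I) =
      h * a μ := by
    have hμ' := hμ
    rw [hr] at hμ'
    obtain ⟨n, rfl⟩ := hμ'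
    exact integral_mul_expi_eq_coeff hh μ₀ (fun n => a (μ₀ + n / h)) _ x₀ Y
      (fun x => (hasSum_expLattice_iff hh hr (fun μ => a μ * expi μ (x + Y * Complex.I)) _).1
        (hs _ (by simpa [mem_halfPlane] using hYr))) n
  rw [← htop]
  -- The series is only available above height `r`. Cauchy's theorem moves the integral down to `y`;
  -- the vertical sides cancel because the integrand is `h`-periodic.
  have hrect := Complex.integral_boundary_rect_eq_zero_of_differentiableOn
    (fun z => f z * expi (-μ) z) (x₀ + y * Complex.I) ((x₀ + h : ℝ) + Y * Complex.I) (by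
      refine (hol.mono fun z hz => ?_).mul (differentiable_expi _).differentiableOn
      have h1 := hz.2
      simp only [Complex.add_im, Complex.ofReal_im, Complex.mul_I_im, Complex.ofReal_re, zero_add,
        Set.mem_preimage, Set.uIcc_of_le hYy.le] at h1
      exact hy.trans_le h1.1)
  simp only [Complex.add_im, Complex.ofReal_im, Complex.mul_I_im, Complex.ofReal_re, zero_add,
    Complex.add_re, Complex.mul_I_re, neg_zero, add_zero] at hrect
  have hside : ∫ t in y..Y, f ((x₀ + h : ℝ) + t * Complex.I) *
      expi (-μ) ((x₀ + h : ℝ) + t * Complex.I) =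
      ∫ t in y..Y, f (x₀ + t * Complex.I) * expi (-μ) (x₀ + t * Complex.I) := by
    refine intervalIntegral.integral_congr fun t ht => ?_
    rw [Set.uIcc_of_le hYy.le] at ht
    have h1 : (((x₀ + h : ℝ) : ℂ) + t * Complex.I) = x₀ + t * Complex.I + h := by push_cast; ring
    have h2 : 0 < (x₀ + t * Complex.I : ℂ).im := by simpa using hy.trans_le ht.1
    have h3 : expi (-μ) h * u = 1 := by
      rw [← mem_expLattice.1 hμ]; exact expi_neg_mul_self _ _
    rw [h1, hper _ h2, expi_add_right]
    linear_combination (f (x₀ + t * Complex.I) * expi (-μ) (x₀ + t * Complex.I)) * h3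
  rw [hside, add_sub_cancel_right, sub_eq_zero] at hrect
  exact hrect

/-- Since `k < 0`, a non-zero `f` has a positive growth exponent at some finite cusp. -/
lemma exists_growth_exponent_pos {k : ℝ} (hk : k < 0) {f : ℂ → ℂ}
    (hne : ∃ z ∈ halfPlane 0, f z ≠ 0) (hol : DifferentiableOn ℂ f (halfPlane 0)) {h : ℝ} {u : ℂ}
    {a : ℝ → ℂ} (hf : IsExpansionAtInfty f h u a)
    (hper : ∀ z : ℂ, 0 < z.im → f (z + h) = u * f z) {ν : SL(2, ℤ) → ℝ} {K : ℝ} (hK : 0 < K)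
    (hb : IsGrowthBound k f ν K) : ∃ γ : SL(2, ℤ), γ 1 0 ≠ 0 ∧ 0 < ν γ := by
  by_contra! hν
  have hh := hf.h_pos
  have hpi := Real.pi_pos
  have ha : ∀ μ ∈ expLattice h u, a μ = 0 := by
    intro μ hμ
    -- The coefficient does not depend on `y`, while the bound contains the positive power `-k` of
    -- `√(2 * y)` and tends to `0` with `y`.
    have hlim : Tendsto (fun y : ℝ => K * √(2 * y) ^ (-k) * Real.exp (2 * Real.pi * μ * y) * h)
        (𝓝[>] 0) (𝓝 0) := by
      have hcont : Continuous fun y : ℝ =>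
          K * √(2 * y) ^ (-k) * Real.exp (2 * Real.pi * μ * y) * h := by
        refine ((continuous_const.mul (Continuous.rpow_const (by fun_prop) fun y =>
          Or.inr (by linarith))).mul (by fun_prop)).mul continuous_const
      have := (hcont.tendsto 0).mono_left (nhdsWithin_le_nhds (s := Set.Ioi 0))
      simpa [Real.zero_rpow (neg_ne_zero.2 hk.ne)] using this
    have hle : ∀ᶠ y : ℝ in 𝓝[>] 0, ‖(h : ℂ) * a μ‖ ≤
        K * √(2 * y) ^ (-k) * Real.exp (2 * Real.pi * μ * y) * h := by
      filter_upwards [nhdsWithin_le_nhds (eventually_lt_nhds (by norm_num : (0 : ℝ) < 1 / 2)),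
        self_mem_nhdsWithin] with y hy hy0
      have hy0 : 0 < y := hy0
      rw [← hf.integral_eq_coeff hol hper hμ 0 hy0]
      refine (intervalIntegral.norm_integral_le_of_norm_le_const fun x _ => ?_).trans_eq
        (by rw [zero_add, sub_zero, abs_of_pos hh])
      have him : (x + y * Complex.I : ℂ).im = y := by simp
      have h1 := hb.norm_le_of_nonpos hK hν (z := x + y * Complex.I) (by rw [him]; exact hy0)
        (by rw [him]; exact hy)
      rw [norm_mul, norm_expi]
      rw [him] at *
      rw [show -(2 * Real.pi * -μ * y) = 2 * Real.pi * μ * y by ring]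
      gcongr
    have h1 := ge_of_tendsto hlim hle
    have h2 : (h : ℂ) * a μ = 0 := norm_le_zero_iff.1 h1
    exact (mul_eq_zero.1 h2).resolve_left (by exact_mod_cast hh.ne')
  obtain ⟨r, -, -, hs⟩ := hf.expansion
  obtain ⟨z, hz, hfz⟩ := exists_slash_ne_zero hne hol k 1 r
  rw [slash_one] at hfz
  have h1 := hs z hz
  simp only [fun μ : expLattice h u => ha μ μ.2, zero_mul] at h1
  exact hfz (h1.unique hasSum_zero)

/-! ### Finite exponential sums and the subdivided period -/

lemma expi_int_eq_one (n : ℤ) : expi 1 n = 1 := by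
  rw [expi, Complex.exp_eq_one_iff]
  exact ⟨n, by push_cast; ring⟩

lemma expi_eq_of_mul_eq {μ ν : ℝ} {x y : ℝ} (h : μ * x = ν * y) : expi μ x = expi ν y := by
  rw [expi, expi]
  congr 1
  have : (μ * x : ℂ) = ν * y := by exact_mod_cast h
  linear_combination (2 * Real.pi * Complex.I) * this

lemma expi_injective_mod {L : ℕ} (hL : 0 < L) (j₀ : ℤ) :
    Function.Injective fun i : Fin L => expi (-(1 / L)) ((j₀ + i : ℤ) : ℝ) := by
  intro i i' hii
  have hpiC : (Real.pi : ℂ) ≠ 0 := by exact_mod_cast Real.pi_pos.ne'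
  have hLC : (L : ℂ) ≠ 0 := by exact_mod_cast hL.ne'
  simp only [expi, Complex.exp_eq_exp_iff_exists_int] at hii
  obtain ⟨n, hn⟩ := hii
  have h1 : ((i' : ℕ) : ℂ) - (i : ℕ) = n * L := by
    apply mul_left_cancel₀ (mul_ne_zero (mul_ne_zero two_ne_zero hpiC) Complex.I_ne_zero)
    push_cast at hn
    field_simp at hn
    linear_combination (2 * Real.pi * Complex.I) * hn
  have h2 : ((i' : ℕ) : ℤ) - (i : ℕ) = n * L := by exact_mod_cast h1
  have h3 := i.2
  have h4 := i'.2
  have h5 : n = 0 := by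
    by_contra h0
    rcases lt_or_gt_of_ne h0 with h | h
    · nlinarith [mul_le_mul_of_nonneg_right (show n ≤ -1 by omega) (show (0 : ℤ) ≤ L by omega)]
    · nlinarith [mul_le_mul_of_nonneg_right (show 1 ≤ n by omega) (show (0 : ℤ) ≤ L by omega)]
  rw [h5, zero_mul] at h2
  exact Fin.ext (by omega)

/-- A non-zero finite exponential sum is non-zero on some residue class. -/
lemma exists_sum_expi_ne_zero {L : ℕ} (hL : 0 < L) (j₀ : ℤ) (v : Fin L → ℂ) (hv : v ≠ 0) :
    ∃ n : ℕ, ∑ i : Fin L, v i * expi (-(n / L)) ((j₀ + i : ℤ) : ℝ) ≠ 0 := by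
  by_contra! hcon
  -- Vandermonde: a vector orthogonal to all powers of pairwise distinct nodes is zero.
  refine hv (Matrix.eq_zero_of_forall_pow_sum_mul_pow_eq_zero (expi_injective_mod hL j₀)
    fun n => ?_)
  rw [← hcon n]
  refine Finset.sum_congr rfl fun i _ => ?_
  congr 1
  rw [expi, expi, ← Complex.exp_nat_mul]
  congr 1
  push_cast; ring

/-- The integral over a period, cut into segments centered at the points `j / Q`. -/
lemma integral_period_eq_sum {f : ℂ → ℂ} (hf : ContinuousOn f (halfPlane 0)) {N Q : ℕ}
    (hQ : 0 < Q) (j₀ : ℤ) (μ : ℝ) {y : ℝ} (hy : 0 < y) :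
    ∫ x in (((j₀ : ℝ) - 1 / 2) / Q)..(((j₀ : ℝ) - 1 / 2) / Q + N),
      f (x + y * Complex.I) * expi (-μ) (x + y * Complex.I) =
    ∑ i ∈ Finset.range (N * Q), expi (-μ) (((j₀ + i : ℤ) / Q : ℝ)) *
      ∫ t in (-(1 / (2 * Q) : ℝ))..(1 / (2 * Q)),
        f (((j₀ + i : ℤ) / Q : ℝ) + (t + y * Complex.I)) * expi (-μ) (t + y * Complex.I) := by
  have hQR : (Q : ℝ) ≠ 0 := by exact_mod_cast hQ.ne'
  have hc : Continuous fun x : ℝ => f (x + y * Complex.I) * expi (-μ) (x + y * Complex.I) :=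
    (hf.comp_continuous (by fun_prop) fun x => by simpa [mem_halfPlane] using hy).mul (by fun_prop)
  have h := intervalIntegral.sum_integral_adjacent_intervals (μ := volume)
    (f := fun x : ℝ => f (x + y * Complex.I) * expi (-μ) (x + y * Complex.I))
    (a := fun i : ℕ => ((j₀ : ℝ) + i - 1 / 2) / Q) (n := N * Q)
    (fun i _ => hc.intervalIntegrable _ _)
  have h0 : ((j₀ : ℝ) + (0 : ℕ) - 1 / 2) / Q = ((j₀ : ℝ) - 1 / 2) / Q := by simp
  have h1 : ((j₀ : ℝ) + (N * Q : ℕ) - 1 / 2) / Q = ((j₀ : ℝ) - 1 / 2) / Q + N := by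
    push_cast; field_simp; ring
  rw [h0, h1] at h
  rw [← h]
  refine Finset.sum_congr rfl fun i _ => ?_
  rw [← intervalIntegral.integral_const_mul]
  have h2 := intervalIntegral.integral_comp_add_left (a := -(1 / (2 * Q) : ℝ)) (b := 1 / (2 * Q))
    (fun x : ℝ => f (x + y * Complex.I) * expi (-μ) (x + y * Complex.I)) ((j₀ + i : ℤ) / Q : ℝ)
  have h3 : ((j₀ + i : ℤ) / Q : ℝ) + -(1 / (2 * Q)) = ((j₀ : ℝ) + i - 1 / 2) / Q := by
    push_cast; field_simp; ring
  have h4 : ((j₀ + i : ℤ) / Q : ℝ) + 1 / (2 * Q) = ((j₀ : ℝ) + (i + 1 : ℕ) - 1 / 2) / Q := by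
    push_cast; field_simp; ring
  rw [h3, h4] at h2
  rw [← h2]
  refine intervalIntegral.integral_congr fun t _ => ?_
  rw [Complex.ofReal_add, add_assoc, expi_add_right]
  ring

/-! ### Assembly of the asymptotics -/

theorem theorem2 (Γ : Subgroup SL(2, ℤ)) (hΓ : Γ.FiniteIndex) (k : ℝ) (hk : k < 0)
    (f : ℂ → ℂ) (hf : IsModularFunction Γ k f) (hne : ∃ z ∈ halfPlane 0, f z ≠ 0)
    (hol : DifferentiableOn ℂ f (halfPlane 0)) :
    StronglyNonLacunary f := by
  have hfin : HasFiniteOrderAtInfty f := by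
    have h := hf.finite_order 1
    rwa [show (fun z => autDenom 1 z ^ (-k : ℂ) * f (moebius 1 z)) = f from slash_one k f] at h
  refine ⟨hfin, ?_⟩
  obtain ⟨N, hN, u, hu, hper⟩ := hf.exists_period hΓ
  have hNR : (0 : ℝ) < N := by exact_mod_cast hN
  obtain ⟨h, u₀, a₀, hexp₀, -⟩ := hfin
  obtain ⟨a, hexp⟩ := hexp₀.exists_of_period hNR hu (R := 0) (by simpa using hper)
  have hperR : ∀ z : ℂ, 0 < z.im → f (z + (N : ℝ)) = u * f z := by simpa using hper
  obtain ⟨ν, hlead, hνfin, K, hK, hb⟩ := hf.exists_growth_exponents hΓ hk hne hol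
  obtain ⟨M, M', hM', hMM', ⟨γ₀, hc₀, hγ₀⟩, hdich, Q, hQ, hdvd⟩ := exists_dominant_exponent hνfin
    (exists_growth_exponent_pos hk hne hol hexp hperR hK hb)
  have hM : 0 < M := hM'.trans hMM'
  have hQR : (0 : ℝ) < Q := by exact_mod_cast hQ
  obtain ⟨κ, hκ0, hκ⟩ := exists_tendsto_integral_cuspModel k hM
  choose C hC hlim using
    exists_tendsto_local_integral hk hol hlead hK hb hM' hMM' hdich hQ hdvd hκ
  obtain ⟨e, he⟩ := hdvd γ₀ hc₀ hγ₀
  -- With `Q = c e`, this makes `j₀ / Q` the dominant cusp of `γ₀`. The subdivision starts there, so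
  -- the first weight is non-zero.
  set j₀ : ℤ := γ₀ 0 0 * e with hj₀
  have hCj₀ : C j₀ ≠ 0 := by
    refine hC j₀ ⟨γ₀, hc₀, hγ₀, ?_⟩
    have heR : (Q : ℝ) = γ₀ 1 0 * e := by exact_mod_cast he
    have hcR : (γ₀ 1 0 : ℝ) ≠ 0 := by exact_mod_cast hc₀
    have : (e : ℝ) ≠ 0 := by rintro h0; rw [h0, mul_zero] at heR; linarith
    rw [heR, hj₀]; push_cast; field_simp
  obtain ⟨μ₀, hr⟩ := exists_expLattice_eq_range hNR hu
  set L : ℕ := N * Q with hL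
  have hL0 : 0 < L := Nat.mul_pos hN hQ
  obtain ⟨n₀, hn₀⟩ := exists_sum_expi_ne_zero hL0 j₀
    (fun i : Fin L => expi (-μ₀) ((j₀ + i : ℤ) / Q : ℝ) * C (j₀ + i)) (fun h0 => by
      have := congrFun h0 ⟨0, hL0⟩
      simp [expi_ne_zero, hCj₀] at this)
  set S : ℂ := ∑ i ∈ Finset.range L, expi (-(μ₀ + n₀ / N)) ((j₀ + i : ℤ) / Q : ℝ) * C (j₀ + i)
    with hS
  have hS0 : S ≠ 0 := by
    convert hn₀ using 1
    rw [hS, Finset.sum_range]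
    refine Finset.sum_congr rfl fun i _ => ?_
    rw [neg_add, expi_add_left, mul_right_comm]
    congr 1
    apply expi_eq_of_mul_eq
    have hLR : (L : ℝ) = N * Q := by rw [hL]; push_cast; rfl
    rw [hLR]; field_simp
  -- Steps of `Q` leave the phases at all points `j / Q` unchanged, so the limiting sum stays equal
  -- to `S`. In units of `1 / N` such a step is `L = N * Q`.
  set lam : ℕ → ℝ := fun n => μ₀ + n₀ / N + Q * n with hlam
  have hlamΛ : ∀ n, lam n ∈ expLattice N u := by
    intro n
    rw [hr]
    refine ⟨n₀ + L * n, ?_⟩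
    simp only [hlam, hL]; push_cast; field_simp; ring
  have hphase : ∀ n i : ℕ, expi (-lam n) ((j₀ + i : ℤ) / Q : ℝ) =
      expi (-(μ₀ + n₀ / N)) ((j₀ + i : ℤ) / Q : ℝ) := by
    intro n i
    have h1 : -lam n = -(μ₀ + n₀ / N) + -(Q * n) := by simp only [hlam]; ring
    have h2 : expi (-(Q * n)) ((j₀ + i : ℤ) / Q : ℝ) = 1 := by
      rw [← expi_int_eq_one (-(n * (j₀ + i))), ← Complex.ofReal_intCast (-(n * (j₀ + i)))]
      apply expi_eq_of_mul_eq
      push_cast; field_simp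
    rw [h1, expi_add_left, h2, mul_one]
  have hlamtop : Tendsto lam atTop atTop :=
    tendsto_atTop_add_const_left _ _ (tendsto_natCast_atTop_atTop.const_mul_atTop hQR)
  -- The saddle height: it satisfies `M / y² = lam n`, the frequency in the local asymptotics.
  set y : ℕ → ℝ := fun n => √(M / lam n) with hy
  have hy0 : Tendsto y atTop (𝓝[>] 0) := by
    refine tendsto_nhdsWithin_iff.2 ⟨?_, ?_⟩
    · have h1 : Tendsto (fun n => M / lam n) atTop (𝓝 0) := hlamtop.const_div_atTop M
      have h2 := (Real.continuous_sqrt.tendsto 0).comp h1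
      rwa [Real.sqrt_zero] at h2
    · filter_upwards [hlamtop.eventually_gt_atTop 0] with n hn
      exact Real.sqrt_pos.2 (div_pos hM hn)
  have hmain : Tendsto (fun n => (saddleWeight k M (y n) : ℂ) * (N * a (lam n))) atTop
      (𝓝 (S * κ)) := by
    have h1 : Tendsto (fun n => ∑ i ∈ Finset.range L,
        expi (-(μ₀ + n₀ / N)) ((j₀ + i : ℤ) / Q : ℝ) * ((saddleWeight k M (y n) : ℂ) *
          ∫ t in (-(1 / (2 * Q) : ℝ))..(1 / (2 * Q)),
          f (((j₀ + i : ℤ) / Q : ℝ) + (t + y n * Complex.I)) *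
            expi (-(M / y n ^ 2)) (t + y n * Complex.I))) atTop
        (𝓝 (∑ i ∈ Finset.range L,
          expi (-(μ₀ + n₀ / N)) ((j₀ + i : ℤ) / Q : ℝ) * (C (j₀ + i) * κ))) :=
      tendsto_finsetSum _ fun i _ => ((hlim (j₀ + i)).comp hy0).const_mul _
    have h2 : S * κ = ∑ i ∈ Finset.range L,
        expi (-(μ₀ + n₀ / N)) ((j₀ + i : ℤ) / Q : ℝ) * (C (j₀ + i) * κ) := by
      rw [hS, Finset.sum_mul]
      exact Finset.sum_congr rfl fun i _ => mul_assoc _ _ _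
    rw [h2]
    refine h1.congr' ?_
    filter_upwards [hlamtop.eventually_gt_atTop 0] with n hn
    have hyn : 0 < y n := Real.sqrt_pos.2 (div_pos hM hn)
    have hMy : M / y n ^ 2 = lam n := by
      rw [hy]; simp only
      rw [Real.sq_sqrt (div_pos hM hn).le]; field_simp
    have h3 := hexp.integral_eq_coeff hol hperR (hlamΛ n) (((j₀ : ℝ) - 1 / 2) / Q) hyn
    rw [integral_period_eq_sum hol.continuousOn hQ j₀ (lam n) hyn] at h3
    rw [Complex.ofReal_natCast] at h3
    rw [← h3, Finset.mul_sum, hMy]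
    refine Finset.sum_congr rfl fun i _ => ?_
    rw [hphase n i]
    ring
  have hev : ∀ᶠ n in atTop, a (lam n) ≠ 0 := by
    filter_upwards [hmain.eventually_ne (mul_ne_zero hS0 hκ0)] with n hn h0
    rw [h0] at hn
    simp at hn
  obtain ⟨n₁, hn₁⟩ := eventually_atTop.1 hev
  refine ⟨N, u, a, hexp, lam n₁, L, hL0, fun n => ?_⟩
  have h1 : lam n₁ + L * (N : ℝ)⁻¹ * n = lam (n₁ + n) := by
    simp only [hlam, hL]; push_cast; field_simp; ring
  rw [h1]
  exact ⟨hlamΛ _, hn₁ _ (Nat.le_add_right _ _)⟩
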